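/- Let $\zeta=e^{2\pi i/6}=\tfrac12+\tfrac{\sqrt3}{2}i$, so $\zeta^2-\zeta+1=0$, let $V=\mathbb C^2$ with standard basis $e_1,e_2$, and put $$\Lambda_{A'}=\mathbb Z\,\zeta e_1\oplus\mathbb Z\,\zeta e_2\oplus\mathbb Z\,e_1\oplus\mathbb Z\,e_2,\qquad \Lambda_A=\mathbb Z\,e_1\oplus\mathbb Z(\zeta e_1+e_2)\oplus\mathbb Z(\zeta e_2+e_2)\oplus\mathbb Z\,2e_2 .$$ Let $A'=V/\Lambda_{A'}$, $A=V/\Lambda_A$, and let $f\colon A\to A'$ be the degree $2$ isogeny induced by $\mathrm{id}_V$. For $k=1,2,3,4$ let $V_k\subset V$ be the complex line spanned by $e_1$, $e_2$, $e_1+e_2$, $e_1+\zeta e_2$, respectively, let $E_k'\subset A'$ be the image of $V_k$, let $E_k=f^*(E_k')$ (an irreducible elliptic curve in $A$), and let $D_A=E_1+E_2+E_3+E_4$. Denote by $\mathrm{Kl}(A,D_A)$ the group of holomorphic and anti-holomorphic diffeomorphisms $g$ of $A$ with $g^*D_A=D_A$, and by $\mathrm{Aut}(A,D_A)$ its subgroup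 of holomorphic elements. Let $\tau\colon A\to A$ be the translation by the $2$-torsion point $a=\zeta e_1+\Lambda_A$. (a) Let $\mathrm{Aut}_0(A,D_A)$ be the group generated by the group automorphisms of $A$ induced by the matrices (with respect to $e_1,e_2$) $$g_2=\begin{pmatrix}\zeta&-1\\ \zeta&-\zeta\end{pmatrix},\qquad g_3=\begin{pmatrix}0&\zeta-1\\ 1-\zeta&\zeta-1\end{pmatrix}.$$ Then $\mathrm{Aut}_0(A,D_A)$ is exactly the subgroup of those elements of $\mathrm{Aut}(A,D_A)$ that are group automorphisms of $A$, and $$\mathrm{Aut}(A,D_A)=\mathrm{Aut}_0(A,D_A)\times\mathbb Z/2\mathbb Z$$ as an internal direct product, where $\mathbb Z/2\mathbb Z$ is generated by $\tau$. As an abstract group $\mathrm{Aut}_0(A,D_A)$ is isomorphic to $\mathsf{SL}(2,\mathbb F_3)$; in particular its order is $24$. (b) The $\mathbb C$-antilinear involution $(z_1,z_2)\mapsto((\zeta-1)\bar z_2,(\zeta-1)\bar z_1)$ of $V$ induces an anti-holomorphic involution $\sigma$ of $A$, and $\mathrm{Kl}(A,D_A)$ is generated by $\mathrm{Aut}(A,D_A)$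 together with $\sigma$. The involutions $\tau$ and $\sigma$ commute. If $\mathrm{Kl}_0(A,D_A)$ denotes the group generated by $g_2,g_3$ and $\sigma$, then $$\mathrm{Kl}(A,D_A)=\mathrm{Kl}_0(A,D_A)\times\mathbb Z/2\mathbb Z$$ as an internal direct product, where $\mathbb Z/2\mathbb Z$ is generated by $\tau$, and $\mathrm{Kl}_0(A,D_A)$ contains $\mathrm{Aut}_0(A,D_A)$ as a subgroup of index $2$. -/

import Mathlib

open scoped Matrix ComplexConjugate

noncomputable section

namespace TypeTwo

/-- `ζ = e^{2πi/6} = 1/2 + (√3/2) i`. -/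
def ζ : ℂ := ⟨1 / 2, Real.sqrt 3 / 2⟩

theorem ζ_sq : ζ * ζ = ζ - 1 := by
  have h : Real.sqrt 3 * Real.sqrt 3 = 3 := Real.mul_self_sqrt (by norm_num)
  apply Complex.ext
  · simp only [ζ, Complex.mul_re, Complex.sub_re, Complex.one_re]; nlinarith
  · simp only [ζ, Complex.mul_im, Complex.sub_im, Complex.one_im]; ring

theorem conj_ζ : conj ζ = 1 - ζ := by
  apply Complex.ext
  · simp [ζ]; norm_num
  · simp [ζ]

/-- The vector space `V = ℂ²`, with its standard basis `e₁ = ![1, 0]`, `e₂ = ![0, 1]`. -/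
abbrev V : Type := Fin 2 → ℂ

/-! ### The abelian surfaces `A' = V / Λ_{A'}`, `A = V / Λ_A` and the isogeny `f : A → A'` -/

/-- `Λ_{A'} = ℤ ζe₁ ⊕ ℤ ζe₂ ⊕ ℤ e₁ ⊕ ℤ e₂`. -/
def ΛA' : AddSubgroup V :=
  AddSubgroup.closure {![ζ, 0], ![0, ζ], ![1, 0], ![0, 1]}

/-- `Λ_A = ℤ e₁ ⊕ ℤ (ζe₁ + e₂) ⊕ ℤ (ζe₂ + e₂) ⊕ ℤ 2e₂`. -/
def ΛA : AddSubgroup V :=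
  AddSubgroup.closure {![1, 0], ![ζ, 1], ![0, ζ + 1], ![0, 2]}

/-- The equianharmonic product `A' = V / Λ_{A'}`. -/
abbrev A' : Type := V ⧸ ΛA'

/-- The abelian surface `A = V / Λ_A`. -/
abbrev A : Type := V ⧸ ΛA

/-- The projection `V → A`. -/
def π (v : V) : A := (v : V ⧸ ΛA)

theorem mem1 : (![1, 0] : V) ∈ ΛA := AddSubgroup.subset_closure (by simp)
theorem mem2 : (![ζ, 1] : V) ∈ ΛA := AddSubgroup.subset_closure (by simp)
theorem mem3 : (![0, ζ + 1] : V) ∈ ΛA := AddSubgroup.subset_closure (by simp)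
theorem mem4 : (![0, 2] : V) ∈ ΛA := AddSubgroup.subset_closure (by simp)

/-- Integral combinations of the four generators of `Λ_A`. -/
theorem mem_ΛA_of (n₁ n₂ n₃ n₄ : ℤ) (x y : ℂ) (hx : x = n₁ + n₂ * ζ)
    (hy : y = n₂ + n₃ * (ζ + 1) + 2 * n₄) : (![x, y] : V) ∈ ΛA := by
  have h : (![x, y] : V) = n₁ • ![1, 0] + n₂ • ![ζ, 1] + n₃ • ![0, ζ + 1] + n₄ • ![0, 2] := by
    ext i
    fin_cases i
    · simp [hx]
    · simp [hy]; ring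
  rw [h]
  exact add_mem (add_mem (add_mem (zsmul_mem mem1 _) (zsmul_mem mem2 _)) (zsmul_mem mem3 _))
    (zsmul_mem mem4 _)

theorem ΛA_le : ΛA ≤ ΛA' := by
  have h1 : (![ζ, 0] : V) ∈ ΛA' := AddSubgroup.subset_closure (by simp)
  have h2 : (![0, ζ] : V) ∈ ΛA' := AddSubgroup.subset_closure (by simp)
  have h3 : (![1, 0] : V) ∈ ΛA' := AddSubgroup.subset_closure (by simp)
  have h4 : (![0, 1] : V) ∈ ΛA' := AddSubgroup.subset_closure (by simp)
  refine (AddSubgroup.closure_le _).2 ?_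
  rintro v (rfl | rfl | rfl | rfl)
  · exact h3
  · simpa using add_mem h1 h4
  · simpa using add_mem h2 h4
  · have := add_mem h4 h4
    norm_num at this
    exact this

/-- The isogeny `f : A → A'` of degree two induced by the identity of `V`. -/
def isogeny : A →+ A' := QuotientAddGroup.map ΛA ΛA' (AddMonoidHom.id V) ΛA_le

/-! ### Holomorphic and anti-holomorphic self-maps of `A` -/

/-- A map `A → A` is holomorphic for the complex structure of `A` as a quotient of `V`, whose
charts are the local inverses of the local biholomorphism `π : V → A`: near each point it is
given in these charts by a holomorphic map between open subsets of `V`. -/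
def IsHolomorphic (f : A → A) : Prop :=
  ∀ v : V, ∃ U : Set V, IsOpen U ∧ v ∈ U ∧ ∃ F : V → V,
    DifferentiableOn ℂ F U ∧ ∀ w ∈ U, f (π w) = π (F w)

/-- A map `A → A` is anti-holomorphic: near each point it is given in the charts of `A` by the
complex conjugate of a holomorphic map. -/
def IsAntiholomorphic (f : A → A) : Prop :=
  ∀ v : V, ∃ U : Set V, IsOpen U ∧ v ∈ U ∧ ∃ F : V → V,
    DifferentiableOn ℂ (fun w i => conj (F w i)) U ∧ ∀ w ∈ U, f (π w) = π (F w)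

theorem differentiableOn_star_star {G : V → V} {U : Set V} (hU : IsOpen U)
    (h : DifferentiableOn ℂ G U) :
    DifferentiableOn ℂ (fun w => star (G (star w))) (star ⁻¹' U) := by
  intro z hz
  have h1 : DifferentiableAt ℂ G (star z) := h.differentiableAt (hU.mem_nhds hz)
  have h2 := h1.star_star
  rw [star_star] at h2
  exact h2.differentiableWithinAt

theorem IsHolomorphic.id : IsHolomorphic (fun x => x) := fun v =>
  ⟨Set.univ, isOpen_univ, trivial, fun w => w, differentiableOn_id, fun _ _ => rfl⟩

theorem IsHolomorphic.comp {g f : A → A} (hg : IsHolomorphic g) (hf : IsHolomorphic f) :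
    IsHolomorphic (g ∘ f) := by
  intro v
  obtain ⟨U, hU, hv, F, hF, hfF⟩ := hf v
  obtain ⟨W, hW, hv', G, hG, hgG⟩ := hg (F v)
  refine ⟨U ∩ F ⁻¹' W, hF.continuousOn.isOpen_inter_preimage hU hW, ⟨hv, hv'⟩, G ∘ F,
    hG.comp (hF.mono Set.inter_subset_left) (fun w hw => hw.2), fun w hw => ?_⟩
  rw [Function.comp_apply, hfF w hw.1, hgG _ hw.2]; rfl

theorem IsAntiholomorphic.comp_holomorphic {g f : A → A} (hg : IsAntiholomorphic g)
    (hf : IsHolomorphic f) : IsAntiholomorphic (g ∘ f) := by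
  intro v
  obtain ⟨U, hU, hv, F, hF, hfF⟩ := hf v
  obtain ⟨W, hW, hv', G, hG, hgG⟩ := hg (F v)
  refine ⟨U ∩ F ⁻¹' W, hF.continuousOn.isOpen_inter_preimage hU hW, ⟨hv, hv'⟩, G ∘ F,
    hG.comp (hF.mono Set.inter_subset_left) (fun w hw => hw.2), fun w hw => ?_⟩
  rw [Function.comp_apply, hfF w hw.1, hgG _ hw.2]; rfl

theorem continuousOn_of_conj {F : V → V} {U : Set V}
    (hF : DifferentiableOn ℂ (fun w i => conj (F w i)) U) : ContinuousOn F U :=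
  (continuous_star.comp_continuousOn hF.continuousOn).congr fun w _ => (star_star (F w)).symm

theorem IsHolomorphic.comp_antiholomorphic {g f : A → A} (hg : IsHolomorphic g)
    (hf : IsAntiholomorphic f) : IsAntiholomorphic (g ∘ f) := by
  intro v
  obtain ⟨U, hU, hv, F, hF, hfF⟩ := hf v
  obtain ⟨W, hW, hv', G, hG, hgG⟩ := hg (F v)
  refine ⟨U ∩ F ⁻¹' W, (continuousOn_of_conj hF).isOpen_inter_preimage hU hW, ⟨hv, hv'⟩, G ∘ F,
    ?_, fun w hw => ?_⟩
  · have h := (differentiableOn_star_star hW hG).comp (hF.mono Set.inter_subset_left)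
      (t := star ⁻¹' W) (s := U ∩ F ⁻¹' W) (fun w hw => by
        change star (star (F w)) ∈ W
        rw [star_star]; exact hw.2)
    refine h.congr fun w _ => ?_
    change star (G (F w)) = star (G (star (star (F w))))
    rw [star_star]
  · rw [Function.comp_apply, hfF w hw.1, hgG _ hw.2]; rfl

theorem IsAntiholomorphic.comp {g f : A → A} (hg : IsAntiholomorphic g)
    (hf : IsAntiholomorphic f) : IsHolomorphic (g ∘ f) := by
  intro v
  obtain ⟨U, hU, hv, F, hF, hfF⟩ := hf v
  obtain ⟨W, hW, hv', G, hG, hgG⟩ := hg (F v)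
  refine ⟨U ∩ F ⁻¹' W, (continuousOn_of_conj hF).isOpen_inter_preimage hU hW, ⟨hv, hv'⟩, G ∘ F,
    ?_, fun w hw => ?_⟩
  · have h := (differentiableOn_star_star hW hG).comp (hF.mono Set.inter_subset_left)
      (t := star ⁻¹' W) (s := U ∩ F ⁻¹' W) (fun w hw => by
        change star (star (F w)) ∈ W
        rw [star_star]; exact hw.2)
    refine h.congr fun w _ => ?_
    change G (F w) = star (star (G (star (star (F w)))))
    rw [star_star, star_star]
  · rw [Function.comp_apply, hfF w hw.1, hgG _ hw.2]; rfl

/-- `Aut(A)`: the group of biholomorphic self-maps of `A`. -/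
def Aut : Subgroup (Equiv.Perm A) where
  carrier := {f | IsHolomorphic f ∧ IsHolomorphic f.symm}
  one_mem' := ⟨IsHolomorphic.id, IsHolomorphic.id⟩
  mul_mem' hf hg := ⟨hf.1.comp hg.1, hg.2.comp hf.2⟩
  inv_mem' hf := ⟨hf.2, hf.1⟩

/-- `Kl(A)`: the group of holomorphic and anti-holomorphic diffeomorphisms of `A`. -/
def Kl : Subgroup (Equiv.Perm A) where
  carrier := {f | (IsHolomorphic f ∧ IsHolomorphic f.symm) ∨
    (IsAntiholomorphic f ∧ IsAntiholomorphic f.symm)}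
  one_mem' := Or.inl ⟨IsHolomorphic.id, IsHolomorphic.id⟩
  mul_mem' := by
    rintro f g (hf | hf) (hg | hg)
    · exact Or.inl ⟨hf.1.comp hg.1, hg.2.comp hf.2⟩
    · exact Or.inr ⟨hf.1.comp_antiholomorphic hg.1, hg.2.comp_holomorphic hf.2⟩
    · exact Or.inr ⟨hf.1.comp_holomorphic hg.1, hg.2.comp_antiholomorphic hf.2⟩
    · exact Or.inl ⟨hf.1.comp hg.1, hg.2.comp hf.2⟩
  inv_mem' := by
    rintro f (hf | hf)
    · exact Or.inl ⟨hf.2, hf.1⟩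
    · exact Or.inr ⟨hf.2, hf.1⟩

/-! ### The divisor `D_A` -/

/-- Spanning vectors of the complex lines `V₁, …, V₄` of `V`. -/
def dir : Fin 4 → V := ![![1, 0], ![0, 1], ![1, 1], ![1, ζ]]

/-- The line `V_k`. -/
def line (k : Fin 4) : Submodule ℂ V := Submodule.span ℂ {dir k}

/-- The elliptic curve `E'_k`, image of `V_k` in `A'`. -/
def curve' (k : Fin 4) : Set A' := (fun v : V => (v : V ⧸ ΛA')) '' (line k : Set V)

/-- The curve `E_k = f^*(E'_k)` in `A`. -/
def curve (k : Fin 4) : Set A := isogeny ⁻¹' curve' k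

theorem mem_or_sub_mem {w : V} (hw : w ∈ ΛA') : w ∈ ΛA ∨ w - ![ζ, 0] ∈ ΛA := by
  have h2 : (![ζ, 0] : V) + ![ζ, 0] ∈ ΛA := by
    have := mem_ΛA_of 0 2 0 (-1) (ζ + ζ) 0 (by push_cast; ring) (by push_cast; ring)
    simpa using this
  induction hw using AddSubgroup.closure_induction with
  | mem x hx =>
    rcases hx with rfl | rfl | rfl | rfl
    · right; simp
    · right
      have := mem_ΛA_of 0 (-1) 1 0 (-ζ) ζ (by push_cast; ring) (by push_cast; ring)
      simpa using this
    · left; exact mem1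
    · right
      have := mem_ΛA_of 0 (-1) 0 1 (-ζ) 1 (by push_cast; ring) (by push_cast; ring)
      simpa using this
  | zero => left; exact ΛA.zero_mem
  | add x y _ _ hx hy =>
    rcases hx with hx | hx <;> rcases hy with hy | hy
    · left; exact add_mem hx hy
    · right; rw [add_sub_assoc]; exact add_mem hx hy
    · right; rw [add_sub_right_comm]; exact add_mem hx hy
    · left
      have := add_mem (add_mem hx hy) h2
      rwa [show x - ![ζ, 0] + (y - ![ζ, 0]) + (![ζ, 0] + ![ζ, 0]) = x + y by abel] at this
  | neg x _ hx =>
    rcases hx with hx | hx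
    · left; exact neg_mem hx
    · right
      have := sub_mem (neg_mem hx) h2
      rwa [show -(x - ![ζ, 0]) - (![ζ, 0] + ![ζ, 0]) = -x - ![ζ, 0] by abel] at this

/-- `E_k` is also the image of the line `V_k` in `A`; in particular it is an irreducible curve. -/
theorem curve_eq_image (k : Fin 4) : curve k = π '' (line k : Set V) := by
  have key : ∃ u ∈ line k, u - ![ζ, 0] ∈ ΛA := by
    fin_cases k
    · exact ⟨![ζ, 0], Submodule.mem_span_singleton.2 ⟨ζ, by simp [dir]⟩, by simp⟩
    · refine ⟨![0, 1], Submodule.mem_span_singleton.2 ⟨1, by simp [dir]⟩, ?_⟩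
      have := mem_ΛA_of 0 (-1) 0 1 (-ζ) 1 (by push_cast; ring) (by push_cast; ring)
      simpa using this
    · refine ⟨![1, 1], Submodule.mem_span_singleton.2 ⟨1, by simp [dir]⟩, ?_⟩
      have := mem_ΛA_of 1 (-1) 0 1 (1 - ζ) 1 (by push_cast; ring) (by push_cast; ring)
      simpa using this
    · refine ⟨![1, ζ], Submodule.mem_span_singleton.2 ⟨1, by simp [dir]⟩, ?_⟩
      have := mem_ΛA_of 1 (-1) 1 0 (1 - ζ) ζ (by push_cast; ring) (by push_cast; ring)
      simpa using this
  obtain ⟨u, hu, hu'⟩ := key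
  ext x
  obtain ⟨v, rfl⟩ := QuotientAddGroup.mk_surjective x
  constructor
  · rintro ⟨l, hl, hlv⟩
    have hm : -l + v ∈ ΛA' := QuotientAddGroup.eq.1 hlv
    rcases mem_or_sub_mem hm with h | h
    · exact ⟨l, hl, QuotientAddGroup.eq.2 h⟩
    · refine ⟨l + u, add_mem hl hu, QuotientAddGroup.eq.2 ?_⟩
      have := sub_mem h hu'
      rwa [show -l + v - ![ζ, 0] - (u - ![ζ, 0]) = -(l + u) + v by abel] at this
  · rintro ⟨l, hl, hlv⟩
    exact ⟨l, hl, QuotientAddGroup.eq.2 (ΛA_le (QuotientAddGroup.eq.1 hlv))⟩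

/-- The divisor `D_A = E₁ + E₂ + E₃ + E₄`, a formal integral combination of curves in `A`. -/
def DA : Set A →₀ ℤ := ∑ k : Fin 4, Finsupp.single (curve k) 1

/-- The pull-back `f^* D` of a divisor along a holomorphic or anti-holomorphic diffeomorphism `f`:
each irreducible curve is replaced by its inverse image. -/
def pullback (f : Equiv.Perm A) (D : Set A →₀ ℤ) : Set A →₀ ℤ :=
  D.mapDomain (fun S => f ⁻¹' S)

theorem pullback_one (D : Set A →₀ ℤ) : pullback 1 D = D := Finsupp.mapDomain_id

theorem pullback_mul (f g : Equiv.Perm A) (D : Set A →₀ ℤ) :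
    pullback (f * g) D = pullback g (pullback f D) :=
  Finsupp.mapDomain_comp (f := fun S => f ⁻¹' S) (g := fun S => g ⁻¹' S)

/-- The group of bijections `f` of `A` with `f^* D_A = D_A`. -/
def stabDA : Subgroup (Equiv.Perm A) where
  carrier := {f | pullback f DA = DA}
  one_mem' := pullback_one DA
  mul_mem' {f g} hf hg := by
    change pullback (f * g) DA = DA
    rw [pullback_mul, show pullback f DA = DA from hf]; exact hg
  inv_mem' {f} hf := by
    change pullback f⁻¹ DA = DA
    have h : pullback (f * f⁻¹) DA = DA := by rw [mul_inv_cancel]; exact pullback_one DA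
    rwa [pullback_mul, show pullback f DA = DA from hf] at h

/-- `Aut(A, D_A)`. -/
def AutDA : Subgroup (Equiv.Perm A) := Aut ⊓ stabDA

/-- `Kl(A, D_A)`. -/
def KlDA : Subgroup (Equiv.Perm A) := Kl ⊓ stabDA

/-! ### The maps `τ`, `g₂`, `g₃`, `σ` -/

/-- The translation `τ` by the point `a = ζe₁ + Λ_A`. -/
def τ : Equiv.Perm A := Equiv.addRight (π ![ζ, 0])

/-- The bijection of `A` induced by an additive bijection of `V` that preserves `Λ_A`. -/
def induced (F G : V →+ V) (hFG : ∀ v, F (G v) = v) (hGF : ∀ v, G (F v) = v)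
    (hF : ΛA ≤ ΛA.comap F) (hG : ΛA ≤ ΛA.comap G) : Equiv.Perm A where
  toFun := QuotientAddGroup.map ΛA ΛA F hF
  invFun := QuotientAddGroup.map ΛA ΛA G hG
  left_inv x := by
    obtain ⟨v, rfl⟩ := QuotientAddGroup.mk_surjective x
    simp [hGF]
  right_inv x := by
    obtain ⟨v, rfl⟩ := QuotientAddGroup.mk_surjective x
    simp [hFG]

/-- The additive map `v ↦ M v`. -/
def ofMatrix (M : Matrix (Fin 2) (Fin 2) ℂ) : V →+ V := M.mulVecLin.toAddMonoidHom

theorem ofMatrix_apply (M : Matrix (Fin 2) (Fin 2) ℂ) (v : V) : ofMatrix M v = M *ᵥ v := rfl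

/-- The matrix of `g₂`. -/
def M₂ : Matrix (Fin 2) (Fin 2) ℂ := !![ζ, -1; ζ, -ζ]

/-- The matrix of `g₃`. -/
def M₃ : Matrix (Fin 2) (Fin 2) ℂ := !![0, ζ - 1; 1 - ζ, ζ - 1]

/-- The inverse of the matrix of `g₃`. -/
def M₃inv : Matrix (Fin 2) (Fin 2) ℂ := !![-ζ, ζ; -ζ, 0]

theorem M₂_mul : M₂ * -M₂ = 1 := by
  have h := ζ_sq
  ext i j
  fin_cases i <;> fin_cases j <;> simp [M₂, Matrix.mul_apply, Fin.sum_univ_two, h]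

theorem M₃_mul : M₃ * M₃inv = 1 := by
  have h := ζ_sq
  ext i j
  fin_cases i <;> fin_cases j <;> simp [M₃, M₃inv, Matrix.mul_apply, Fin.sum_univ_two]
  · linear_combination -h
  · ring
  · linear_combination -h

theorem M₂_mem : ΛA ≤ ΛA.comap (ofMatrix M₂) := by
  have h := ζ_sq
  refine (AddSubgroup.closure_le _).2 ?_
  rintro v (rfl | rfl | rfl | rfl) <;>
    simp only [SetLike.mem_coe, AddSubgroup.mem_comap, ofMatrix_apply, M₂, Matrix.cons_mulVec,
      Matrix.cons_dotProduct, Matrix.dotProduct_of_isEmpty, Matrix.empty_mulVec]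
  · exact mem_ΛA_of 0 1 1 (-1) _ _ (by simp; try ring) (by simp; try ring)
  · exact mem_ΛA_of (-2) 1 0 (-1) _ _ (by simp; linear_combination h)
      (by simp; linear_combination h)
  · exact mem_ΛA_of (-1) (-1) (-2) 2 _ _ (by simp; try ring) (by simp; linear_combination -h)
  · exact mem_ΛA_of (-2) 0 (-2) 1 _ _ (by simp; try ring) (by simp; try ring)

theorem negM₂_mem : ΛA ≤ ΛA.comap (ofMatrix (-M₂)) := by
  intro v hv
  have h : M₂ *ᵥ v ∈ ΛA := M₂_mem hv
  rw [AddSubgroup.mem_comap, ofMatrix_apply, Matrix.neg_mulVec]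
  exact neg_mem h

theorem M₃_mem : ΛA ≤ ΛA.comap (ofMatrix M₃) := by
  have h := ζ_sq
  refine (AddSubgroup.closure_le _).2 ?_
  rintro v (rfl | rfl | rfl | rfl) <;>
    simp only [SetLike.mem_coe, AddSubgroup.mem_comap, ofMatrix_apply, M₃, Matrix.cons_mulVec,
      Matrix.cons_dotProduct, Matrix.dotProduct_of_isEmpty, Matrix.empty_mulVec]
  · exact mem_ΛA_of 0 0 (-1) 1 _ _ (by simp; try ring) (by simp; try ring)
  · exact mem_ΛA_of (-1) 1 1 (-1) _ _ (by simp; try ring) (by simp; linear_combination -h)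
  · exact mem_ΛA_of (-2) 1 1 (-2) _ _ (by simp; linear_combination h)
      (by simp; linear_combination h)
  · exact mem_ΛA_of (-2) 2 2 (-3) _ _ (by simp; try ring) (by simp; try ring)

theorem M₃inv_mem : ΛA ≤ ΛA.comap (ofMatrix M₃inv) := by
  have h := ζ_sq
  refine (AddSubgroup.closure_le _).2 ?_
  rintro v (rfl | rfl | rfl | rfl) <;>
    simp only [SetLike.mem_coe, AddSubgroup.mem_comap, ofMatrix_apply, M₃inv, Matrix.cons_mulVec,
      Matrix.cons_dotProduct, Matrix.dotProduct_of_isEmpty, Matrix.empty_mulVec]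
  · exact mem_ΛA_of 0 (-1) (-1) 1 _ _ (by simp; try ring) (by simp; try ring)
  · exact mem_ΛA_of 1 0 (-1) 1 _ _ (by simp; linear_combination -h)
      (by simp; linear_combination -h)
  · exact mem_ΛA_of (-1) 2 0 (-1) _ _ (by simp; linear_combination h) (by simp; try ring)
  · exact mem_ΛA_of 0 2 0 (-1) _ _ (by simp; try ring) (by simp; try ring)

/-- The automorphism `g₂` of `A`, induced by the matrix `M₂`. -/
def g₂ : Equiv.Perm A :=
  induced (ofMatrix M₂) (ofMatrix (-M₂))
    (fun v => by
      rw [ofMatrix_apply, ofMatrix_apply, Matrix.mulVec_mulVec, M₂_mul, Matrix.one_mulVec])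
    (fun v => by
      rw [ofMatrix_apply, ofMatrix_apply, Matrix.mulVec_mulVec, mul_eq_one_comm.1 M₂_mul,
        Matrix.one_mulVec])
    M₂_mem negM₂_mem

/-- The automorphism `g₃` of `A`, induced by the matrix `M₃`. -/
def g₃ : Equiv.Perm A :=
  induced (ofMatrix M₃) (ofMatrix M₃inv)
    (fun v => by
      rw [ofMatrix_apply, ofMatrix_apply, Matrix.mulVec_mulVec, M₃_mul, Matrix.one_mulVec])
    (fun v => by
      rw [ofMatrix_apply, ofMatrix_apply, Matrix.mulVec_mulVec, mul_eq_one_comm.1 M₃_mul,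
        Matrix.one_mulVec])
    M₃_mem M₃inv_mem

/-- The antilinear map `(z₁, z₂) ↦ ((ζ - 1) z̄₂, (ζ - 1) z̄₁)` of `V`. -/
def antilin : V →+ V where
  toFun z := ![(ζ - 1) * conj (z 1), (ζ - 1) * conj (z 0)]
  map_zero' := by
    ext i; fin_cases i <;> simp
  map_add' x y := by
    ext i; fin_cases i <;> simp [mul_add]

theorem antilin_apply (z : V) :
    antilin z = ![(ζ - 1) * conj (z 1), (ζ - 1) * conj (z 0)] := rfl

theorem antilin_antilin (z : V) : antilin (antilin z) = z := by
  have h := ζ_sq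
  ext i
  fin_cases i <;> simp [antilin_apply, conj_ζ]
  · linear_combination -z 0 * h
  · linear_combination -z 1 * h

theorem antilin_mem : ΛA ≤ ΛA.comap antilin := by
  have h := ζ_sq
  refine (AddSubgroup.closure_le _).2 ?_
  rintro v (rfl | rfl | rfl | rfl) <;>
    simp only [SetLike.mem_coe, AddSubgroup.mem_comap, antilin_apply]
  · exact mem_ΛA_of 0 0 1 (-1) _ _ (by simp) (by simp; try ring)
  · exact mem_ΛA_of (-1) 1 1 (-1) _ _ (by simp; try ring)
      (by simp [conj_ζ]; linear_combination -h)
  · exact mem_ΛA_of (-1) 2 0 (-1) _ _ (by simp [conj_ζ]; linear_combination -h) (by simp)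
  · exact mem_ΛA_of (-2) 2 0 (-1) _ _ (by simp [Complex.conj_ofNat]; ring) (by simp)

/-- The map `σ` of `A` induced by `(z₁, z₂) ↦ ((ζ - 1) z̄₂, (ζ - 1) z̄₁)`. -/
def σ : Equiv.Perm A :=
  induced antilin antilin antilin_antilin antilin_antilin antilin_mem antilin_mem

theorem τ_apply (v : V) : τ (π v) = π (v + ![ζ, 0]) := rfl

theorem g₂_apply (v : V) : g₂ (π v) = π (M₂ *ᵥ v) := rfl

theorem g₃_apply (v : V) : g₃ (π v) = π (M₃ *ᵥ v) := rfl

theorem σ_apply (z : V) :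
    σ (π z) = π ![(ζ - 1) * conj (z 1), (ζ - 1) * conj (z 0)] := rfl

/-- `Aut₀(A, D_A)`, the subgroup generated by `g₂` and `g₃`. -/
def Aut₀DA : Subgroup (Equiv.Perm A) := Subgroup.closure {g₂, g₃}

/-- `Kl₀(A, D_A)`, the subgroup generated by `g₂`, `g₃` and `σ`. -/
def Kl₀DA : Subgroup (Equiv.Perm A) := Subgroup.closure {g₂, g₃, σ}

end TypeTwo

end

/-! The common points of the four curves are exactly the two classes 0 and a of Λ_{A'} in `A`. A
bijection preserving D_A pulls each curve back to one of the curves, so it preserves {0, a}; hence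
it fixes 0, possibly after composition with `τ`.

A holomorphic self-map of `A` is affine (`IsHolomorphic.exists_affine`): the derivatives of its
local lifts glue to a Λ_A-periodic function on V, which is constant by Liouville. If it also fixes 0
and preserves D_A, it is linear and maps Λ_{A'} to itself, so it is given by a matrix over the
Eisenstein integers which permutes the four lines. The inverse has the same form, so the determinant
is a unit and the columns are unit multiples of two of the four direction vectors. Among these
finitely many candidates, a check by computation (`exists_eisWord_of_eisCols`) leaves 24 matrices,
each an explicit word in g₂ and g₃. Reduction modulo √-3 embeds them in SL(2, 𝔽₃), which also has 24
elements.

Composition with `σ` reduces the anti-holomorphic elements to the holomorphic ones. The generators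
`g₂`, `g₃`, `σ` are additive and fix a, so they commute with `τ`; since they fix 0, `τ` is not in
the group they generate. `Subgroup.exists_mulEquiv_prod_zmod_two` then gives both direct products.
-/

/-- A subgroup and a central involution outside of it form an internal direct product. -/
theorem Subgroup.exists_mulEquiv_prod_zmod_two {G : Type*} [Group G] {H K : Subgroup G} {t : G}
    (hHK : H ≤ K) (htK : t ∈ K) (ht : t ^ 2 = 1) (htH : t ∉ H) (hc : ∀ h ∈ H, Commute h t)
    (hK : ∀ k ∈ K, k ∈ H ∨ t * k ∈ H) :
    ∃ φ : H × Multiplicative (ZMod 2) ≃* K,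
      (∀ g : H, (φ (g, 1) : G) = g) ∧ (φ (1, Multiplicative.ofAdd 1) : G) = t := by
  let ψ : Multiplicative (ZMod 2) →* G :=
    { toFun := fun z => t ^ (Multiplicative.toAdd z).val
      map_one' := by simp
      map_mul' := fun a b => by
        rw [toAdd_mul, ZMod.val_add, ← pow_eq_pow_mod _ ht, pow_add] }
  have hψ : ∀ z, (z = 1 ∧ ψ z = 1) ∨ (z = Multiplicative.ofAdd 1 ∧ ψ z = t) := by
    intro z
    have h2 : ∀ z : ZMod 2, z = 0 ∨ z = 1 := by decide
    rcases h2 (Multiplicative.toAdd z) with h | h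
    · left
      have h' : z = 1 := h
      exact ⟨h', by rw [h', map_one]⟩
    · right
      have h' : z = Multiplicative.ofAdd 1 := h
      refine ⟨h', ?_⟩
      rw [h']
      exact pow_one t
  let Φ : H × Multiplicative (ZMod 2) →* G :=
    H.subtype.noncommCoprod ψ fun h z => (hc h h.2).pow_right _
  have hΦ : ∀ g z, Φ (g, z) = g * ψ z := fun g z => rfl
  have hmem : ∀ p, Φ p ∈ K := fun p => K.mul_mem (hHK p.1.2) (K.pow_mem htK _)
  have hbij : Function.Bijective (Φ.codRestrict K hmem) := by
    constructor
    · rw [injective_iff_map_eq_one]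
      rintro ⟨g, z⟩ h
      have h1 : (g : G) * ψ z = 1 := congrArg Subtype.val h
      rcases hψ z with ⟨rfl, hz⟩ | ⟨rfl, hz⟩
      · rw [hz, mul_one] at h1
        exact Prod.ext (Subtype.ext h1) rfl
      · rw [hz] at h1
        exact absurd (eq_inv_of_mul_eq_one_right h1 ▸ H.inv_mem g.2) htH
    · rintro ⟨k, hk⟩
      have ht' : t * t = 1 := by rw [← sq, ht]
      have hψt : ψ (Multiplicative.ofAdd 1) = t := pow_one t
      rcases hK k hk with h | h
      · exact ⟨(⟨k, h⟩, 1), Subtype.ext (by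
          change k * ψ 1 = k
          rw [map_one, mul_one])⟩
      -- Since t commutes with tk ∈ H and t² = 1, one has k = (tk)t.
      · refine ⟨(⟨t * k, h⟩, Multiplicative.ofAdd 1), Subtype.ext ?_⟩
        change t * k * ψ _ = k
        rw [hψt, (hc _ h).eq, ← mul_assoc, ht', one_mul]
  refine ⟨MulEquiv.ofBijective _ hbij, fun g => ?_, ?_⟩
  · change (g : G) * ψ 1 = g
    rw [map_one, mul_one]
  · change ((1 : H) : G) * t ^ 1 = t
    simp

noncomputable section

namespace TypeTwo

open QuadraticAlgebra

/-! ### Eisenstein integers -/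

/-- The Eisenstein integers `ℤ[ω]`, with `ω² = ω - 1`. -/
abbrev Eis : Type := QuadraticAlgebra ℤ (-1) 1

/-- The embedding of the Eisenstein integers in `ℂ` which maps `ω` to `ζ`. -/
def eisToComplex : Eis →+* ℂ :=
  (lift (⟨ζ, by rw [ζ_sq]; simp; ring⟩ : {u : ℂ // u * u = (-1 : ℤ) • 1 + (1 : ℤ) • u})).toRingHom

theorem eisToComplex_apply (x : Eis) : eisToComplex x = x.re + x.im * ζ := by
  simp [eisToComplex, lift]

/-- Reduction of the Eisenstein integers modulo `√-3`. -/
def eisMod : Eis →+* ZMod 3 :=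
  -- Modulo 3, X² - X + 1 = (X + 1)², so -1 is the only possible image of ω.
  (lift (⟨-1, by decide⟩ : {u : ZMod 3 // u * u = (-1 : ℤ) • 1 + (1 : ℤ) • u})).toRingHom

theorem eisMod_apply (x : Eis) : eisMod x = x.re - x.im := by
  simp [eisMod, lift, sub_eq_add_neg]

theorem ζ_im_sq : ζ.im * ζ.im = 3 / 4 := by
  have h : Real.sqrt 3 * Real.sqrt 3 = 3 := Real.mul_self_sqrt (by norm_num)
  simp only [ζ]; linarith

theorem normSq_eisToComplex (x : Eis) : Complex.normSq (eisToComplex x) = norm x := by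
  have h := ζ_im_sq
  have hre : ζ.re = 1 / 2 := rfl
  rw [eisToComplex_apply, Complex.normSq_apply, norm_def]
  simp [hre]
  linear_combination (x.im : ℝ) ^ 2 * h

theorem norm_nonneg' (x : Eis) : 0 ≤ norm x := by
  rw [norm_def]; nlinarith [sq_nonneg (2 * x.re + x.im), sq_nonneg x.im]

theorem norm_pos_of_ne_zero {x : Eis} (hx : x ≠ 0) : 0 < norm x := by
  refine (norm_nonneg' x).lt_of_ne fun h => hx ?_
  rw [norm_def] at h
  have h1 : x.im = 0 := by nlinarith [sq_nonneg (2 * x.re + x.im), sq_nonneg x.im]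
  have h2 : x.re = 0 := by rw [h1] at h; nlinarith
  ext <;> simp [h1, h2]

/-- The squared absolute value is a positive integer. This is the source of every discreteness
argument below. -/
theorem one_le_norm_eisToComplex {x : Eis} (hx : x ≠ 0) : 1 ≤ ‖eisToComplex x‖ := by
  have h : (1 : ℝ) ≤ ‖eisToComplex x‖ * ‖eisToComplex x‖ := by
    rw [← sq, ← Complex.normSq_eq_norm_sq, normSq_eisToComplex]
    exact_mod_cast norm_pos_of_ne_zero hx
  nlinarith [norm_nonneg (eisToComplex x)]

theorem eisToComplex_injective : Function.Injective eisToComplex := by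
  rw [injective_iff_map_eq_zero]
  intro x hx
  by_contra h
  have := one_le_norm_eisToComplex h
  rw [hx, _root_.norm_zero] at this
  linarith

theorem exists_conj_eisToComplex (x : Eis) : ∃ y : Eis, eisToComplex y = conj (eisToComplex x) := by
  refine ⟨⟨x.re + x.im, -x.im⟩, ?_⟩
  rw [eisToComplex_apply, eisToComplex_apply]
  simp [conj_ζ]; ring

theorem eisToComplex_omega : eisToComplex ω = ζ := by
  rw [eisToComplex_apply]; simp

/-- The six units of the Eisenstein integers. -/
def eisUnit : Fin 6 → Eis := ![1, -1, ω, -ω, ω - 1, 1 - ω]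

/-- A unit has norm a² + ab + b² = 1, and 4(a² + ab + b²) = (a + 2b)² + 3a² bounds a by 1, likewise
b; nine cases remain. -/
theorem exists_eisUnit {x y : Eis} (h : x * y = 1) : ∃ i, x = eisUnit i := by
  have hn : norm x * norm y = 1 := by rw [← map_mul, h, map_one]
  have h1 : norm x = 1 := by
    rcases Int.isUnit_iff.1 (IsUnit.of_mul_eq_one _ hn) with h | h
    · exact h
    · have := norm_nonneg' x; omega
  obtain ⟨a, b⟩ := x
  rw [norm_def] at h1
  simp only at h1
  have ha : -1 ≤ a ∧ a ≤ 1 := by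
    constructor <;> nlinarith [sq_nonneg (a + 2 * b), sq_nonneg a]
  have hb : -1 ≤ b ∧ b ≤ 1 := by
    constructor <;> nlinarith [sq_nonneg (2 * a + b), sq_nonneg b]
  obtain ⟨ha, ha'⟩ := ha
  obtain ⟨hb, hb'⟩ := hb
  clear h hn
  interval_cases a <;> interval_cases b <;> first | (exfalso; revert h1; decide) | decide

/-! ### Matrices over the Eisenstein integers -/

/-- The matrix of `g₂`. -/
def eisM₂ : Matrix (Fin 2) (Fin 2) Eis := !![ω, -1; ω, -ω]

/-- The matrix of `g₃`. -/
def eisM₃ : Matrix (Fin 2) (Fin 2) Eis := !![0, ω - 1; 1 - ω, ω - 1]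

/-- The inverse of the matrix of `g₃`. -/
def eisM₃inv : Matrix (Fin 2) (Fin 2) Eis := !![-ω, ω; -ω, 0]

/-- The elements of the group generated by `eisM₂` and `eisM₃`: the products of an element of the
quaternion group generated by `eisM₂` and its conjugate by `eisM₃`, and a power of `eisM₃`. -/
def eisWord (a : Fin 4 × Fin 2 × Fin 3) : Matrix (Fin 2) (Fin 2) Eis :=
  eisM₂ ^ (a.1 : ℕ) * (eisM₃ * eisM₂ * eisM₃inv) ^ (a.2.1 : ℕ) * eisM₃ ^ (a.2.2 : ℕ)

/-- Spanning vectors of the four lines. -/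
def eisDir : Fin 4 → Fin 2 → Eis := ![![1, 0], ![0, 1], ![1, 1], ![1, ω]]

/-- Linear forms defining the four lines. -/
def eisForm : Fin 4 → Fin 2 → Eis := ![![0, 1], ![1, 0], ![1, -1], ![-ω, 1]]

/-- The vectors of `Λ_A` among the pairs of Eisenstein integers. -/
def EisLattice (v : Fin 2 → Eis) : Prop := Even ((v 0).im + (v 1).re + (v 1).im)

instance (v : Fin 2 → Eis) : Decidable (EisLattice v) := by unfold EisLattice; infer_instance

/-! ### Eisenstein matrices which permute the four lines. -/

theorem exists_smul_eisDir (k : Fin 4) (v : Fin 2 → Eis) (h : eisForm k ⬝ᵥ v = 0) :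
    ∃ c : Eis, v = c • eisDir k := by
  rw [dotProduct, Fin.sum_univ_two] at h
  fin_cases k <;> simp [eisForm] at h
  · exact ⟨v 0, by funext i; fin_cases i <;> simp [eisDir, h]⟩
  · exact ⟨v 1, by funext i; fin_cases i <;> simp [eisDir, h]⟩
  · have h' : v 1 = v 0 := by linear_combination -h
    exact ⟨v 0, by funext i; fin_cases i <;> simp [eisDir, h']⟩
  · have h' : v 1 = v 0 * ω := by linear_combination h
    exact ⟨v 0, by funext i; fin_cases i <;> simp [eisDir, h']⟩

/-- The matrix with columns proportional to the vectors `eisDir i` and `eisDir j`. -/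
def eisCols (i j : Fin 4) (a b : Eis) : Matrix (Fin 2) (Fin 2) Eis :=
  !![a * eisDir i 0, b * eisDir j 0; a * eisDir i 1, b * eisDir j 1]

-- The finite core of the classification: 4 · 4 · 6 · 6 candidates. The scalar ω preserves every
-- line; the lattice condition on the first column is what excludes it.
set_option maxRecDepth 100000 in
set_option maxHeartbeats 4000000 in
theorem exists_eisWord_of_eisCols : ∀ (i j : Fin 4) (a b : Fin 6),
    i ≠ j →
    EisLattice (eisCols i j (eisUnit a) (eisUnit b) *ᵥ eisDir 0) →
    (∃ k, eisForm k ⬝ᵥ eisCols i j (eisUnit a) (eisUnit b) *ᵥ eisDir 2 = 0) →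
    (∃ k, eisForm k ⬝ᵥ eisCols i j (eisUnit a) (eisUnit b) *ᵥ eisDir 3 = 0) →
    ∃ x, eisCols i j (eisUnit a) (eisUnit b) = eisWord x := by
  decide +kernel

/-- The columns are the images of e₁ and e₂, so they are multiples a, b of two direction vectors.
Both a and b divide the invertible determinant, hence are units, and the two lines are distinct. -/
theorem exists_eisWord {M N : Matrix (Fin 2) (Fin 2) Eis} (hMN : M * N = 1)
    (hlat : EisLattice (M *ᵥ eisDir 0)) (hdir : ∀ j, ∃ k, eisForm k ⬝ᵥ M *ᵥ eisDir j = 0) :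
    ∃ x, M = eisWord x := by
  obtain ⟨i, hi⟩ := hdir 0
  obtain ⟨j, hj⟩ := hdir 1
  obtain ⟨a, ha⟩ := exists_smul_eisDir i _ hi
  obtain ⟨b, hb⟩ := exists_smul_eisDir j _ hj
  have hM : M = eisCols i j a b := by
    have ha0 := congrFun ha 0
    have ha1 := congrFun ha 1
    have hb0 := congrFun hb 0
    have hb1 := congrFun hb 1
    simp [eisDir, Matrix.mulVec, dotProduct, -Pi.smul_apply] at ha0 ha1 hb0 hb1
    funext r s
    fin_cases r <;> fin_cases s <;> simp [eisCols]
    · exact ha0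
    · exact hb0
    · exact ha1
    · exact hb1
  have hdet : a * b * ((eisDir i 0 * eisDir j 1 - eisDir j 0 * eisDir i 1) * N.det) = 1 := by
    rw [← Matrix.det_one (n := Fin 2) (R := Eis), ← hMN, Matrix.det_mul, hM, eisCols,
      Matrix.det_fin_two_of]
    ring
  obtain ⟨a', ha'⟩ := exists_eisUnit (x := a) (y := b * _) (by rw [← hdet, mul_assoc])
  obtain ⟨b', hb'⟩ := exists_eisUnit (x := b) (y := a * _)
    (by rw [← hdet, mul_left_comm, ← mul_assoc])
  have hij : i ≠ j := by
    rintro rfl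
    rw [mul_comm (eisDir i 0), sub_self, zero_mul, mul_zero] at hdet
    exact zero_ne_one hdet
  rw [ha', hb'] at hM
  obtain ⟨x, hx⟩ := exists_eisWord_of_eisCols i j a' b' hij (hM ▸ hlat) (hM ▸ hdir 2)
    (hM ▸ hdir 3)
  exact ⟨x, hM.trans hx⟩

/-! ### Reduction of the 24 words modulo √-3. -/

theorem det_map_eisWord_int : ∀ x,
    ((eisWord x).det.re : ZMod 3) - ((eisWord x).det.im : ZMod 3) = 1 := by decide +kernel

/-- The matrix `eisM₃` has determinant -ω, so the determinant becomes 1 only after reduction. -/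
theorem det_map_eisMod_eisWord (x) : ((eisWord x).map eisMod).det = 1 := by
  rw [← RingHom.mapMatrix_apply, ← RingHom.map_det, eisMod_apply, det_map_eisWord_int]

theorem eisWord_injective_int : ∀ x y,
    (∀ i j, (((eisWord x i j).re : ZMod 3) - ((eisWord x i j).im : ZMod 3)) =
      (((eisWord y i j).re : ZMod 3) - ((eisWord y i j).im : ZMod 3))) → x = y := by
  decide +kernel

theorem eisWord_map_eisMod_injective :
    Function.Injective fun x => (eisWord x).map eisMod := by
  intro x y h
  refine eisWord_injective_int x y fun i j => ?_
  rw [← eisMod_apply, ← eisMod_apply]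
  exact congrFun (congrFun h i) j

theorem card_SL_two_three : Fintype.card (Matrix.SpecialLinearGroup (Fin 2) (ZMod 3)) = 24 := by
  decide +kernel

/-! ### The lattices in terms of Eisenstein integers -/

/-- The embedding of pairs of Eisenstein integers in `V`. -/
def eisVec (v : Fin 2 → Eis) : V := fun i => eisToComplex (v i)

theorem eisVec_injective : Function.Injective eisVec := fun _ _ h =>
  funext fun i => eisToComplex_injective (congrFun h i)

theorem mem_ΛA'_iff {v : V} : v ∈ ΛA' ↔ ∃ x, v = eisVec x := by
  constructor
  · intro hv
    induction hv using AddSubgroup.closure_induction with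
    | mem x hx =>
      rcases hx with rfl | rfl | rfl | rfl
      · exact ⟨![ω, 0], by ext i; fin_cases i <;> simp [eisVec, eisToComplex_omega]⟩
      · exact ⟨![0, ω], by ext i; fin_cases i <;> simp [eisVec, eisToComplex_omega]⟩
      · exact ⟨![1, 0], by ext i; fin_cases i <;> simp [eisVec]⟩
      · exact ⟨![0, 1], by ext i; fin_cases i <;> simp [eisVec]⟩
    | zero => exact ⟨0, by ext i; simp [eisVec]⟩
    | add x y _ _ hx hy =>
      obtain ⟨a, rfl⟩ := hx
      obtain ⟨b, rfl⟩ := hy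
      exact ⟨a + b, by ext i; simp [eisVec]⟩
    | neg x _ hx =>
      obtain ⟨a, rfl⟩ := hx
      exact ⟨-a, by ext i; simp [eisVec]⟩
  · rintro ⟨x, rfl⟩
    have h1 : (![ζ, 0] : V) ∈ ΛA' := AddSubgroup.subset_closure (by simp)
    have h2 : (![0, ζ] : V) ∈ ΛA' := AddSubgroup.subset_closure (by simp)
    have h3 : (![1, 0] : V) ∈ ΛA' := AddSubgroup.subset_closure (by simp)
    have h4 : (![0, 1] : V) ∈ ΛA' := AddSubgroup.subset_closure (by simp)
    have h : eisVec x = (x 0).im • ![ζ, 0] + (x 1).im • ![0, ζ] + (x 0).re • ![1, 0]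
        + (x 1).re • ![0, 1] := by
      ext i; fin_cases i <;> simp [eisVec, eisToComplex_apply] <;> ring
    rw [h]
    exact add_mem (add_mem (add_mem (zsmul_mem h1 _) (zsmul_mem h2 _)) (zsmul_mem h3 _))
      (zsmul_mem h4 _)

theorem eisVec_mem_ΛA_iff {x : Fin 2 → Eis} : eisVec x ∈ ΛA ↔ EisLattice x := by
  constructor
  · intro hx
    have key : ∀ v ∈ ΛA, ∃ y, v = eisVec y ∧ EisLattice y := by
      intro v hv
      induction hv using AddSubgroup.closure_induction with
      | mem x hx =>
        rcases hx with rfl | rfl | rfl | rfl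
        · exact ⟨![1, 0], by ext i; fin_cases i <;> simp [eisVec], by decide⟩
        · exact ⟨![ω, 1], by ext i; fin_cases i <;> simp [eisVec, eisToComplex_omega], by decide⟩
        · exact ⟨![0, ω + 1], by ext i; fin_cases i <;> simp [eisVec, eisToComplex_omega],
            by decide⟩
        · exact ⟨![0, 2], by
            ext i; fin_cases i
            · simp [eisVec]
            · exact (map_ofNat eisToComplex 2).symm, by decide⟩
      | zero => exact ⟨0, by ext i; simp [eisVec], by decide⟩
      | add x y _ _ hx hy =>
        obtain ⟨a, rfl, n, hn⟩ := hx
        obtain ⟨b, rfl, m, hm⟩ := hy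
        exact ⟨a + b, by ext i; simp [eisVec], n + m, by
          simp only [Pi.add_apply, re_add, im_add]; linarith⟩
      | neg x _ hx =>
        obtain ⟨a, rfl, n, hn⟩ := hx
        exact ⟨-a, by ext i; simp [eisVec], -n, by
          simp only [Pi.neg_apply, re_neg, im_neg]; linarith⟩
    obtain ⟨y, hy, hy'⟩ := key _ hx
    rwa [eisVec_injective hy]
  · rintro ⟨n, hn⟩
    -- The parity condition is exactly what makes the coefficient of 2e₂ an integer.
    have h := mem_ΛA_of (x 0).re (x 0).im (x 1).im (n - (x 0).im - (x 1).im)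
      (eisToComplex (x 0)) (eisToComplex (x 1)) (eisToComplex_apply _) (by
        have hn' : (x 1).re = (n + n) - (x 0).im - (x 1).im := by linarith
        rw [eisToComplex_apply, hn']; push_cast; ring)
    convert h using 1
    ext i; fin_cases i <;> rfl

theorem one_le_norm_of_mem_ΛA' {v : V} (hv : v ∈ ΛA') (h0 : v ≠ 0) : 1 ≤ ‖v‖ := by
  obtain ⟨x, rfl⟩ := mem_ΛA'_iff.1 hv
  obtain ⟨i, hi⟩ := Function.ne_iff.1 h0
  refine (one_le_norm_eisToComplex (x := x i) fun h => hi ?_).trans (norm_le_pi_norm (eisVec x) i)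
  simp [eisVec, h]

/-- An additive map with values in the lattice vanishes, because `V` is divisible. -/
theorem eq_zero_of_forall_mem_ΛA' (F : V →+ V) (h : ∀ v, F v ∈ ΛA') (v : V) : F v = 0 := by
  by_contra h0
  -- The nonzero lattice vector F(v/n) has norm at least 1, so ‖F v‖ = n‖F(v/n)‖ ≥ n, against the
  -- choice of n.
  obtain ⟨n, hn⟩ := exists_nat_gt ‖F v‖
  have hn0 : (n : ℝ) ≠ 0 := by
    rintro h
    rw [h] at hn
    exact absurd hn (not_lt.2 (norm_nonneg _))
  have h1 : (n : ℝ) • ((n : ℝ)⁻¹ • v) = v := by rw [smul_smul, mul_inv_cancel₀ hn0, one_smul]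
  rw [Nat.cast_smul_eq_nsmul] at h1
  have h2 : F v = n • F ((n : ℝ)⁻¹ • v) := by rw [← map_nsmul, h1]
  have h3 : F ((n : ℝ)⁻¹ • v) ≠ 0 := fun h => h0 (by rw [h2, h, smul_zero])
  have h4 := one_le_norm_of_mem_ΛA' (h _) h3
  rw [h2, ← Nat.cast_smul_eq_nsmul ℝ, norm_smul, Real.norm_natCast] at hn
  have : (0 : ℝ) ≤ n := n.cast_nonneg
  nlinarith

theorem π_eq_π_iff {v w : V} : π v = π w ↔ v - w ∈ ΛA := by
  rw [eq_comm]
  exact QuotientAddGroup.eq.trans (by rw [neg_add_eq_sub])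

theorem π_eq_zero_iff {v : V} : π v = 0 ↔ v ∈ ΛA := QuotientAddGroup.eq_zero_iff v

theorem π_add (v w : V) : π (v + w) = π v + π w := rfl

theorem π_surjective : Function.Surjective π := QuotientAddGroup.mk_surjective

theorem eq_of_forall_π_eq (F G : V →+ V) (h : ∀ v, π (F v) = π (G v)) (v : V) : F v = G v :=
  sub_eq_zero.1 <| eq_zero_of_forall_mem_ΛA' (F - G) (fun v => ΛA_le (π_eq_π_iff.1 (h v))) v

/-- Every point of `A` is the image of a vector in a fixed ball. -/
theorem exists_norm_le_sub_mem_ΛA (v : V) : ∃ w : V, ‖w‖ ≤ 8 ∧ v - w ∈ ΛA := by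
  have hζ : ζ.im ≠ 0 := fun h => by have := ζ_im_sq; rw [h] at this; norm_num at this
  have hζn : ‖ζ‖ = 1 := by
    have h : ‖ζ‖ * ‖ζ‖ = 1 := by
      rw [← sq, ← Complex.normSq_eq_norm_sq, Complex.normSq_apply, ζ_im_sq]
      simp [ζ]; norm_num
    nlinarith [norm_nonneg ζ]
  -- Since 2Λ_{A'} ⊆ Λ_A, the coordinates in the basis 1, ζ may be reduced modulo 2. The remainder
  -- has norm below 4, so 8 is a generous bound.
  have key : ∀ z : ℂ, ∃ x : Eis, ‖z - eisToComplex ⟨2 * x.re, 2 * x.im⟩‖ ≤ 8 := by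
    intro z
    set q : ℝ := z.im / ζ.im with hq
    set p : ℝ := z.re - q * ζ.re with hp
    have hz : z = p + q * ζ := by
      apply Complex.ext
      · simp [hp]
      · simp [hq, hζ]
    refine ⟨⟨⌊p / 2⌋, ⌊q / 2⌋⟩, ?_⟩
    have h1 : z - eisToComplex ⟨2 * ⌊p / 2⌋, 2 * ⌊q / 2⌋⟩ =
        ((2 * Int.fract (p / 2) : ℝ) : ℂ) + ((2 * Int.fract (q / 2) : ℝ) : ℂ) * ζ := by
      rw [eisToComplex_apply, ← Int.self_sub_floor, ← Int.self_sub_floor]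
      conv_lhs => rw [hz]
      push_cast; ring
    rw [h1]
    refine (norm_add_le _ _).trans ?_
    rw [norm_mul, hζn, Complex.norm_real, Complex.norm_real, Real.norm_eq_abs, Real.norm_eq_abs,
      abs_of_nonneg (by have := Int.fract_nonneg (p / 2); linarith),
      abs_of_nonneg (by have := Int.fract_nonneg (q / 2); linarith)]
    have := Int.fract_lt_one (p / 2)
    have := Int.fract_lt_one (q / 2)
    linarith
  choose x hx using fun i => key (v i)
  refine ⟨v - eisVec fun i => ⟨2 * (x i).re, 2 * (x i).im⟩,
    (pi_norm_le_iff_of_nonneg (by norm_num)).2 hx, ?_⟩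
  rw [sub_sub_cancel, eisVec_mem_ΛA_iff]
  exact ⟨(x 0).im + (x 1).re + (x 1).im, by ring⟩

/-! ### Holomorphic self-maps are affine -/

/-- Two local lifts of the same map differ by a constant near each common point. -/
theorem eventually_sub_eq_of_lifts {X : Type*} [TopologicalSpace X] {F G : X → V} {x : X}
    (hF : ContinuousAt F x) (hG : ContinuousAt G x)
    (h : ∀ᶠ y in nhds x, π (F y) = π (G y)) : ∀ᶠ y in nhds x, F y - G y = F x - G x := by
  -- The difference is continuous at x with values in Λ_A near x, and distinct lattice points are at
  -- distance at least 1.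
  have hc : ContinuousAt (fun y => F y - G y) x := hF.sub hG
  filter_upwards [h, hc (Metric.ball_mem_nhds _ one_pos)] with y hy hy1
  by_contra hne
  have h1 := one_le_norm_of_mem_ΛA' (ΛA_le (sub_mem (π_eq_π_iff.1 hy) (π_eq_π_iff.1 h.self_of_nhds)))
    (sub_ne_zero.2 hne)
  rw [Set.mem_preimage, mem_ball_iff_norm] at hy1
  linarith

/-- Local lifts differ by constants, so the derivative depends only on the map of `A`; this lets
derivatives of local lifts be glued. -/
theorem fderiv_eq_of_lifts {F G : V → V} {v : V} (hF : DifferentiableAt ℂ F v)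
    (hG : DifferentiableAt ℂ G v) (h : ∀ᶠ w in nhds v, π (F w) = π (G w)) :
    fderiv ℂ F v = fderiv ℂ G v := by
  have h1 := eventually_sub_eq_of_lifts hF.continuousAt hG.continuousAt h
  have h2 : F =ᶠ[nhds v] fun w => G w + (F v - G v) := by
    filter_upwards [h1] with w hw
    rw [← hw]; abel
  rw [h2.fderiv_eq, fderiv_add_const]

/-- Liouville is applied in one variable: for fixed u, the function t ↦ D(tu)u is entire, and it is
bounded by periodicity and compactness. Hence f(π(tu)) - π(t D(0)u) is locally constant in t ∈ ℂ,
and comparing t = 1 with t = 0 gives the formula. -/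
theorem IsHolomorphic.exists_affine {f : A → A} (hf : IsHolomorphic f) :
    ∃ L : V →L[ℂ] V, ∀ v, f (π v) = f 0 + π (L v) := by
  choose U hU hvU F hF hfF using hf
  have hFd : ∀ v, ∀ w ∈ U v, DifferentiableAt ℂ (F v) w := fun v w hw =>
    (hF v).differentiableAt ((hU v).mem_nhds hw)
  set D : V → V →L[ℂ] V := fun v => fderiv ℂ (F v) v with hD
  have hDF : ∀ v, ∀ w ∈ U v, fderiv ℂ (F v) w = D w := fun v w hw => by
    refine fderiv_eq_of_lifts (hFd v w hw) (hFd w w (hvU w)) ?_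
    filter_upwards [(hU v).mem_nhds hw, (hU w).mem_nhds (hvU w)] with y hy hy'
    rw [← hfF v y hy, ← hfF w y hy']
  have hper : ∀ v w, v - w ∈ ΛA → D v = D w := fun v w hvw => by
    have h1 : DifferentiableAt ℂ (fun y => F w (y - (v - w))) v := by
      have : DifferentiableAt ℂ (F w) (v - (v - w)) := by
        rw [sub_sub_cancel]; exact hFd w w (hvU w)
      exact this.comp v (differentiableAt_id.sub_const _)
    have h2 : fderiv ℂ (F v) v = fderiv ℂ (fun y => F w (y - (v - w))) v := by
      refine fderiv_eq_of_lifts (hFd v v (hvU v)) h1 ?_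
      have hc : ContinuousAt (fun y => y - (v - w)) v := by fun_prop
      have hn : U w ∈ nhds (v - (v - w)) := by
        rw [sub_sub_cancel]; exact (hU w).mem_nhds (hvU w)
      filter_upwards [(hU v).mem_nhds (hvU v), hc hn] with y hy hy'
      rw [← hfF v y hy, ← hfF w _ hy']
      congr 1
      rw [π_eq_π_iff, sub_sub_cancel]; exact hvw
    rw [hD]
    simp only
    rw [h2, fderiv_comp_sub, sub_sub_cancel]
  refine ⟨D 0, fun u => ?_⟩
  -- the derivative along `u` is bounded
  have hlocal : ∀ v, ∃ C : ℝ, ∀ᶠ w in nhds v, ‖D w u‖ ≤ C := fun v => by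
    have hc : ContinuousAt (fun p : V × ℂ => p.1 + p.2 • u) (v, 0) := by fun_prop
    have hFc : ContinuousAt (F v) (v + (0 : ℂ) • u) := by
      simpa using (hFd v v (hvU v)).continuousAt
    have hUn : U v ∈ nhds (v + (0 : ℂ) • u) := by
      simpa using (hU v).mem_nhds (hvU v)
    have h1 : ∀ᶠ p : V × ℂ in nhds (v, 0), p.1 + p.2 • u ∈ U v ∧
        ‖F v (p.1 + p.2 • u)‖ < ‖F v (v + (0 : ℂ) • u)‖ + 1 := by
      have h2 : ContinuousAt (fun y => ‖F v y‖) (v + (0 : ℂ) • u) := hFc.norm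
      have h3 := h2 (Iio_mem_nhds (lt_add_one _))
      filter_upwards [hc hUn, hc h3] with p hp hp'
      exact ⟨hp, hp'⟩
    rw [nhds_prod_eq] at h1
    obtain ⟨pa, ha, pb, hb, hab⟩ := Filter.eventually_prod_iff.1 h1
    obtain ⟨r, hr, hrb⟩ := Metric.eventually_nhds_iff_ball.1 hb
    -- The Cauchy estimate on the circle of radius r/2, uniform for w near v.
    refine ⟨(‖F v (v + (0 : ℂ) • u)‖ + 1) / (r / 2), ?_⟩
    filter_upwards [ha] with w hw
    have hsub : ∀ t ∈ Metric.closedBall (0 : ℂ) (r / 2), pb t := fun t ht =>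
      hrb t (Metric.closedBall_subset_ball (half_lt_self hr) ht)
    have hder : ∀ t, pb t → HasDerivAt (fun t : ℂ => F v (w + t • u))
        (fderiv ℂ (F v) (w + t • u) u) t := fun t ht => by
      have h4 := (hFd v _ (hab hw ht).1).hasFDerivAt
      have h5 : HasDerivAt (fun t : ℂ => w + t • u) u t := by
        simpa using ((hasDerivAt_id t).smul_const u).const_add w
      exact h4.comp_hasDerivAt t h5
    have h0 : deriv (fun t : ℂ => F v (w + t • u)) 0 = D w u := by
      have h0b : pb 0 := hsub 0 (Metric.mem_closedBall_self (half_pos hr).le)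
      have hwU := (hab hw h0b).1
      rw [(hder 0 h0b).deriv]
      rw [zero_smul, add_zero] at hwU ⊢
      rw [hDF v w hwU]
    rw [← h0]
    refine Complex.norm_deriv_le_of_forall_mem_sphere_norm_le (half_pos hr) ?_ ?_
    · refine DifferentiableOn.diffContOnCl fun t ht => ?_
      rw [closure_ball _ (half_pos hr).ne'] at ht
      exact (hder t (hsub t ht)).differentiableAt.differentiableWithinAt
    · intro t ht
      exact (hab hw (hsub t (Metric.sphere_subset_closedBall ht))).2.le
  obtain ⟨C, hC⟩ : ∃ C : ℝ, ∀ v, ‖D v u‖ ≤ C := by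
    choose C hC using hlocal
    obtain ⟨t, -, ht⟩ := (isCompact_closedBall (0 : V) 8).elim_nhds_subcover
      (fun v => {w | ‖D w u‖ ≤ C v}) (fun v _ => hC v)
    -- The sum of absolute values serves as an upper bound for the finitely many local bounds on the
    -- ball.
    refine ⟨∑ v ∈ t, |C v|, fun v => ?_⟩
    obtain ⟨w, hw, hvw⟩ := exists_norm_le_sub_mem_ΛA v
    rw [hper v w hvw]
    obtain ⟨x, hx, hxw⟩ := Set.mem_iUnion₂.1 (ht (mem_closedBall_zero_iff.2 hw))
    exact (hxw.trans (le_abs_self _)).trans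
      (Finset.single_le_sum (f := fun v => |C v|) (fun _ _ => abs_nonneg _) hx)
  -- the lifts along the line `t ↦ t u`
  have hcont : ∀ t₀ : ℂ, ∀ᶠ t in nhds t₀, t • u ∈ U (t₀ • u) := fun t₀ =>
    (by fun_prop : ContinuousAt (fun t : ℂ => t • u) t₀) ((hU _).mem_nhds (hvU _))
  have hder : ∀ t₀ t : ℂ, t • u ∈ U (t₀ • u) →
      HasDerivAt (fun t : ℂ => F (t₀ • u) (t • u)) (D (t • u) u) t := fun t₀ t ht => by
    have h5 : HasDerivAt (fun t : ℂ => t • u) u t := by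
      simpa using (hasDerivAt_id t).smul_const u
    rw [← hDF _ _ ht]
    exact (hFd _ _ ht).hasFDerivAt.comp_hasDerivAt t h5
  have hdiff : Differentiable ℂ fun t : ℂ => D (t • u) u := fun t₀ => by
    obtain ⟨r, hr, hrb⟩ := Metric.eventually_nhds_iff_ball.1 (hcont t₀)
    have h1 : DifferentiableOn ℂ (fun t : ℂ => F (t₀ • u) (t • u)) (Metric.ball t₀ r) :=
      fun t ht => (hder t₀ t (hrb t ht)).differentiableAt.differentiableWithinAt
    have h2 := (h1.deriv Metric.isOpen_ball).differentiableAt (Metric.ball_mem_nhds t₀ hr)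
    refine h2.congr_of_eventuallyEq ?_
    filter_upwards [hcont t₀] with t ht
    exact (hder t₀ t ht).deriv.symm
  have hconst : ∀ t : ℂ, D (t • u) u = D 0 u := fun t => by
    have h1 := hdiff.apply_eq_apply_of_bounded
      (isBounded_iff_forall_norm_le.2 ⟨C, by rintro _ ⟨t, rfl⟩; exact hC _⟩) t 0
    simpa using h1
  have hloc : IsLocallyConstant fun t : ℂ => f (π (t • u)) - π (t • D 0 u) := by
    rw [IsLocallyConstant.iff_eventually_eq]
    intro t₀
    obtain ⟨r, hr, hrb⟩ := Metric.eventually_nhds_iff_ball.1 (hcont t₀)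
    have hd : ∀ t ∈ Metric.ball t₀ r,
        HasDerivAt (fun t : ℂ => F (t₀ • u) (t • u) - t • D 0 u) 0 t := fun t ht => by
      have h1 := (hder t₀ t (hrb t ht)).sub ((hasDerivAt_id t).smul_const (D 0 u))
      rw [hconst, one_smul, sub_self] at h1
      exact h1
    filter_upwards [Metric.ball_mem_nhds t₀ hr] with t ht
    have h2 := Metric.isOpen_ball.is_const_of_deriv_eq_zero
      (convex_ball t₀ r).isPreconnected
      (fun t ht => (hd t ht).differentiableAt.differentiableWithinAt)
      (fun t ht => (hd t ht).deriv) ht (Metric.mem_ball_self hr)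
    rw [hfF _ _ (hrb t ht), hfF _ _ (hrb t₀ (Metric.mem_ball_self hr))]
    exact congrArg π h2
  have h1 := hloc.apply_eq_of_preconnectedSpace 1 0
  simp only [one_smul, zero_smul] at h1
  have hπ0 : π 0 = 0 := rfl
  rw [hπ0, sub_zero] at h1
  exact sub_eq_iff_eq_add.1 h1

/-! ### The curves and the stabilizer of `D_A` -/

theorem dir_eq (k : Fin 4) : dir k = eisVec (eisDir k) := by
  ext i; fin_cases k <;> fin_cases i <;> simp [dir, eisDir, eisVec, eisToComplex_omega]

theorem eisVec_dotProduct (x y : Fin 2 → Eis) :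
    eisVec x ⬝ᵥ eisVec y = eisToComplex (x ⬝ᵥ y) := by
  simp [eisVec, dotProduct]

theorem eisForm_dotProduct_eisDir : ∀ k, eisForm k ⬝ᵥ eisDir k = 0 := by decide

theorem mem_line_of_dotProduct_eq_zero (k : Fin 4) (v : V) (h : eisVec (eisForm k) ⬝ᵥ v = 0) :
    v ∈ line k := by
  rw [dotProduct, Fin.sum_univ_two] at h
  refine Submodule.mem_span_singleton.2 ?_
  fin_cases k <;> simp [eisForm, eisVec, eisToComplex_omega] at h
  · exact ⟨v 0, by funext i; fin_cases i <;> simp [dir, h]⟩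
  · exact ⟨v 1, by funext i; fin_cases i <;> simp [dir, h]⟩
  · have h' : v 1 = v 0 := by linear_combination -h
    exact ⟨v 0, by funext i; fin_cases i <;> simp [dir, h']⟩
  · have h' : v 1 = v 0 * ζ := by linear_combination h
    exact ⟨v 0, by funext i; fin_cases i <;> simp [dir, h']⟩

/-- Each form vanishes on its line and has a unit coefficient, so it maps Λ_{A'} onto the Eisenstein
integers with the line as its kernel in V. Membership in a curve becomes integrality of one linear
form. -/
theorem π_mem_curve_iff {k : Fin 4} {v : V} :
    π v ∈ curve k ↔ ∃ x, eisVec (eisForm k) ⬝ᵥ v = eisToComplex x := by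
  constructor
  · rintro ⟨l, hl, hlv⟩
    obtain ⟨y, hy⟩ := mem_ΛA'_iff.1 (QuotientAddGroup.eq.1 hlv)
    obtain ⟨c, rfl⟩ := Submodule.mem_span_singleton.1 hl
    refine ⟨eisForm k ⬝ᵥ y, ?_⟩
    rw [← eisVec_dotProduct, ← hy, dotProduct_add, dotProduct_neg, dotProduct_smul, dir_eq,
      eisVec_dotProduct, eisForm_dotProduct_eisDir]
    simp
  · rintro ⟨x, hx⟩
    obtain ⟨y, hy⟩ : ∃ y, eisForm k ⬝ᵥ y = x := by
      fin_cases k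
      · exact ⟨![0, x], by simp [eisForm]⟩
      · exact ⟨![x, 0], by simp [eisForm]⟩
      · exact ⟨![x, 0], by simp [eisForm]⟩
      · exact ⟨![0, x], by simp [eisForm]⟩
    refine ⟨v - eisVec y, mem_line_of_dotProduct_eq_zero k _ ?_, QuotientAddGroup.eq.2 ?_⟩
    · rw [dotProduct_sub, eisVec_dotProduct, hx, hy, sub_self]
    · exact mem_ΛA'_iff.2 ⟨y, by simp⟩

/-- The forms of index 1 and 0 are the two coordinates, so two of the curves already force
integrality. -/
theorem mem_ΛA'_iff_forall_mem_curve {v : V} : v ∈ ΛA' ↔ ∀ k, π v ∈ curve k := by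
  rw [mem_ΛA'_iff]
  constructor
  · rintro ⟨x, rfl⟩ k
    exact π_mem_curve_iff.2 ⟨_, eisVec_dotProduct _ _⟩
  · intro h
    obtain ⟨x, hx⟩ := π_mem_curve_iff.1 (h 1)
    obtain ⟨y, hy⟩ := π_mem_curve_iff.1 (h 0)
    refine ⟨![x, y], ?_⟩
    simp [eisForm, eisVec, dotProduct] at hx hy
    ext i; fin_cases i <;> simp [eisVec, hx, hy]

theorem eq_zero_or_eq_of_forall_mem_curve {x : A} (h : ∀ k, x ∈ curve k) :
    x = 0 ∨ x = π ![ζ, 0] := by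
  obtain ⟨v, rfl⟩ := π_surjective x
  rw [π_eq_zero_iff, π_eq_π_iff]
  exact mem_or_sub_mem (mem_ΛA'_iff_forall_mem_curve.2 h)

theorem ζ_vec_mem_ΛA' : (![ζ, 0] : V) ∈ ΛA' := AddSubgroup.subset_closure (by simp)

theorem π_ζ_vec_ne_zero : π ![ζ, 0] ≠ 0 := by
  have h : (![ζ, 0] : V) = eisVec ![ω, 0] := by
    ext i; fin_cases i <;> simp [eisVec, eisToComplex_omega]
  rw [Ne, π_eq_zero_iff, h, eisVec_mem_ΛA_iff]
  decide

theorem mem_stabDA_of_perm {f : Equiv.Perm A} (s : Equiv.Perm (Fin 4))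
    (h : ∀ k, f ⁻¹' curve k = curve (s k)) : f ∈ stabDA := by
  change pullback f DA = DA
  unfold pullback DA
  rw [← Finsupp.mapDomain.addMonoidHom_apply, map_sum]
  simp only [Finsupp.mapDomain.addMonoidHom_apply, Finsupp.mapDomain_single, h]
  exact Equiv.sum_comp s fun k => Finsupp.single (curve k) (1 : ℤ)

/-- As S ↦ f⁻¹(S) is injective, the coefficient of D_A at the preimage equals its coefficient at the
curve, which is positive; the support of D_A consists of the four curves. Their distinctness plays
no role. -/
theorem exists_preimage_curve_eq {f : Equiv.Perm A} (hf : f ∈ stabDA) (k : Fin 4) :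
    ∃ j, f ⁻¹' curve k = curve j := by
  have h1 : DA (curve k) ≠ 0 := by
    unfold DA
    rw [Finsupp.finsetSum_apply]
    have h2 : (1 : ℤ) ≤ ∑ j : Fin 4, Finsupp.single (curve j) (1 : ℤ) (curve k) := by
      refine le_trans (b := Finsupp.single (curve k) (1 : ℤ) (curve k)) (by simp)
        (Finset.single_le_sum (f := fun j => Finsupp.single (curve j) (1 : ℤ) (curve k))
          (fun j _ => ?_) (Finset.mem_univ k))
      classical
      rw [Finsupp.single_apply]; split_ifs <;> norm_num
    omega
  have h2 : DA (f ⁻¹' curve k) = DA (curve k) := by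
    have h3 : pullback f DA = DA := hf
    exact (DFunLike.congr_fun h3 _).symm.trans (Finsupp.mapDomain_apply
      (f := fun S : Set A => f ⁻¹' S) (Set.preimage_injective.2 f.surjective) DA (curve k))
  by_contra! h
  refine h1 (h2 ▸ ?_)
  unfold DA
  rw [Finsupp.finsetSum_apply]
  exact Finset.sum_eq_zero fun j _ => Finsupp.single_eq_of_ne (h j)

theorem preimage_curve_eq_of_lift {f : Equiv.Perm A} {F : V → V} (hF : ∀ v, f (π v) = π (F v))
    {k j : Fin 4}
    (h : ∀ v, (∃ x, eisVec (eisForm k) ⬝ᵥ F v = eisToComplex x) ↔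
      ∃ x, eisVec (eisForm j) ⬝ᵥ v = eisToComplex x) :
    f ⁻¹' curve k = curve j := by
  ext y
  obtain ⟨v, rfl⟩ := π_surjective y
  rw [Set.mem_preimage, hF, π_mem_curve_iff, h, π_mem_curve_iff]

theorem apply_mem_curve_of_mem_stabDA {f : Equiv.Perm A} (hf : f ∈ stabDA) {x : A}
    (hx : ∀ k, x ∈ curve k) (k : Fin 4) : f x ∈ curve k := by
  obtain ⟨j, hj⟩ := exists_preimage_curve_eq hf k
  exact hj.symm.subset (hx j)

theorem zero_mem_curve (k : Fin 4) : (0 : A) ∈ curve k :=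
  mem_ΛA'_iff_forall_mem_curve.1 (zero_mem _) k

theorem apply_zero_of_mem_stabDA {f : Equiv.Perm A} (hf : f ∈ stabDA) :
    f 0 = 0 ∨ f 0 = π ![ζ, 0] :=
  eq_zero_or_eq_of_forall_mem_curve (apply_mem_curve_of_mem_stabDA hf zero_mem_curve)

theorem apply_π_ζ_vec_of_mem_stabDA {f : Equiv.Perm A} (hf : f ∈ stabDA) (h0 : f 0 = 0) :
    f (π ![ζ, 0]) = π ![ζ, 0] := by
  refine (eq_zero_or_eq_of_forall_mem_curve (apply_mem_curve_of_mem_stabDA hf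
    (mem_ΛA'_iff_forall_mem_curve.1 ζ_vec_mem_ΛA'))).resolve_left fun h => ?_
  exact π_ζ_vec_ne_zero (f.injective (h.trans h0.symm))

/-! ### Maps induced by matrices of Eisenstein integers -/

theorem exists_mul_eq_iff {u u' : Eis} (hu : u' * u = 1) (z : ℂ) :
    (∃ x, eisToComplex u * z = eisToComplex x) ↔ ∃ x, z = eisToComplex x := by
  constructor
  · rintro ⟨x, hx⟩
    exact ⟨u' * x, by rw [map_mul, ← hx, ← mul_assoc, ← map_mul, hu, map_one, one_mul]⟩
  · rintro ⟨x, rfl⟩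
    exact ⟨u * x, by rw [map_mul]⟩

/-- The map `f` of `A` is induced by the matrix `M`. -/
def IsInducedBy (f : Equiv.Perm A) (M : Matrix (Fin 2) (Fin 2) Eis) : Prop :=
  ∀ v, f (π v) = π (M.map eisToComplex *ᵥ v)

theorem map_mulVec_eisVec (M : Matrix (Fin 2) (Fin 2) Eis) (x : Fin 2 → Eis) :
    M.map eisToComplex *ᵥ eisVec x = eisVec (M *ᵥ x) := by
  funext i
  exact (RingHom.map_mulVec eisToComplex M x i).symm

namespace IsInducedBy

variable {f g : Equiv.Perm A} {M N : Matrix (Fin 2) (Fin 2) Eis}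

theorem one : IsInducedBy 1 1 := fun v => by
  rw [Matrix.map_one _ (map_zero _) (map_one _), Matrix.one_mulVec]; rfl

theorem mul (hf : IsInducedBy f M) (hg : IsInducedBy g N) : IsInducedBy (f * g) (M * N) :=
  fun v => by
    rw [Equiv.Perm.mul_apply, hg, hf, Matrix.mulVec_mulVec, Matrix.map_mul]

theorem pow (hf : IsInducedBy f M) (n : ℕ) : IsInducedBy (f ^ n) (M ^ n) := by
  induction n with
  | zero => simpa using one
  | succ n ih => rw [pow_succ, pow_succ]; exact ih.mul hf

/-- Two matrices inducing the same map differ by an additive map into the lattice, which is zero. -/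
theorem unique (hM : IsInducedBy f M) (hN : IsInducedBy f N) : M = N := by
  have h := eq_of_forall_π_eq (ofMatrix (M.map eisToComplex)) (ofMatrix (N.map eisToComplex))
    fun v => (hM v).symm.trans (hN v)
  have h' : M.map eisToComplex = N.map eisToComplex := Matrix.ext_iff_mulVec.2 h
  exact Matrix.map_injective eisToComplex_injective h'

theorem perm_eq (hf : IsInducedBy f M) (hg : IsInducedBy g M) : f = g := by
  ext x
  obtain ⟨v, rfl⟩ := π_surjective x
  rw [hf, hg]

theorem isHolomorphic (hf : IsInducedBy f M) : IsHolomorphic f := fun _ =>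
  ⟨Set.univ, isOpen_univ, trivial, fun w => M.map eisToComplex *ᵥ w,
    (LinearMap.toContinuousLinearMap (M.map eisToComplex).mulVecLin).differentiable.differentiableOn,
    fun w _ => hf w⟩

theorem map_add (hf : IsInducedBy f M) (x y : A) : f (x + y) = f x + f y := by
  obtain ⟨v, rfl⟩ := π_surjective x
  obtain ⟨w, rfl⟩ := π_surjective y
  rw [← π_add, hf, hf, hf, ← π_add, Matrix.mulVec_add]

/-- The preimage of a curve is cut out by its form composed with M, and a unit factor does not
affect integrality. -/
theorem mem_AutDA (hf : IsInducedBy f M) (hf' : IsInducedBy f⁻¹ N) (s : Equiv.Perm (Fin 4))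
    (h : ∀ k, ∃ i, eisForm k ᵥ* M = eisUnit i • eisForm (s k)) : f ∈ AutDA := by
  refine ⟨⟨hf.isHolomorphic, hf'.isHolomorphic⟩, mem_stabDA_of_perm s fun k => ?_⟩
  refine preimage_curve_eq_of_lift hf fun v => ?_
  obtain ⟨i, hi⟩ := h k
  have hu : ∃ j, eisUnit j * eisUnit i = 1 := by clear hi; revert i; decide
  obtain ⟨j, hu⟩ := hu
  have h1 : eisVec (eisForm k) ⬝ᵥ M.map eisToComplex *ᵥ v
      = eisToComplex (eisUnit i) * (eisVec (eisForm (s k)) ⬝ᵥ v) := by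
    have h2 : eisVec (eisForm k) ᵥ* M.map eisToComplex = eisVec (eisForm k ᵥ* M) := by
      funext j
      exact (RingHom.map_vecMul eisToComplex M (eisForm k) j).symm
    rw [Matrix.dotProduct_mulVec, h2, hi, ← smul_eq_mul, ← smul_dotProduct]
    congr 1
    funext j
    simp [eisVec]
  rw [h1]
  exact exists_mul_eq_iff hu _

end IsInducedBy

/-! ### The generators, and the automorphisms fixing the origin. -/

theorem isInducedBy_g₂ : IsInducedBy g₂ eisM₂ := fun v => by
  have h : eisM₂.map eisToComplex = M₂ := by
    ext i j; fin_cases i <;> fin_cases j <;> simp [eisM₂, M₂, eisToComplex_omega]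
  rw [h, g₂_apply]

theorem isInducedBy_g₂_inv : IsInducedBy g₂⁻¹ (-eisM₂) := fun v => by
  have h : (-eisM₂).map eisToComplex = -M₂ := by
    ext i j; fin_cases i <;> fin_cases j <;> simp [eisM₂, M₂, eisToComplex_omega]
  rw [h]; rfl

theorem isInducedBy_g₃ : IsInducedBy g₃ eisM₃ := fun v => by
  have h : eisM₃.map eisToComplex = M₃ := by
    ext i j; fin_cases i <;> fin_cases j <;> simp [eisM₃, M₃, eisToComplex_omega]
  rw [h, g₃_apply]

theorem isInducedBy_g₃_inv : IsInducedBy g₃⁻¹ eisM₃inv := fun v => by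
  have h : eisM₃inv.map eisToComplex = M₃inv := by
    ext i j; fin_cases i <;> fin_cases j <;> simp [eisM₃inv, M₃inv, eisToComplex_omega]
  rw [h]; rfl

theorem g₂_mem_AutDA : g₂ ∈ AutDA := by
  obtain ⟨s, hs⟩ : ∃ s : Equiv.Perm (Fin 4), ∀ k, ∃ i,
      eisForm k ᵥ* eisM₂ = eisUnit i • eisForm (s k) := by decide +kernel
  exact isInducedBy_g₂.mem_AutDA isInducedBy_g₂_inv s hs

theorem g₃_mem_AutDA : g₃ ∈ AutDA := by
  obtain ⟨s, hs⟩ : ∃ s : Equiv.Perm (Fin 4), ∀ k, ∃ i,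
      eisForm k ᵥ* eisM₃ = eisUnit i • eisForm (s k) := by decide +kernel
  exact isInducedBy_g₃.mem_AutDA isInducedBy_g₃_inv s hs

/-- The classes of e₁ and e₂ lie on all four curves, hence so do their images; the columns of the
linear part are therefore in Λ_{A'}. -/
theorem exists_isInducedBy_of_mem_AutDA {f : Equiv.Perm A} (hf : f ∈ AutDA) (h0 : f 0 = 0) :
    ∃ M, IsInducedBy f M := by
  obtain ⟨D, hD⟩ := hf.1.1.exists_affine
  have hD' : ∀ v, f (π v) = π (D v) := fun v => by rw [hD, h0, zero_add]
  have h1 : ∀ i : Fin 2, ∃ x, D (Pi.single i 1) = eisVec x := fun i => by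
    rw [← mem_ΛA'_iff, mem_ΛA'_iff_forall_mem_curve, ← hD']
    refine apply_mem_curve_of_mem_stabDA hf.2 (mem_ΛA'_iff_forall_mem_curve.1 ?_)
    refine mem_ΛA'_iff.2 ⟨Pi.single i 1, ?_⟩
    ext j; fin_cases i <;> fin_cases j <;> simp [eisVec]
  choose x hx using h1
  refine ⟨Matrix.of fun i j => x j i, fun v => ?_⟩
  rw [hD']
  congr 1
  have hv : v = v 0 • Pi.single 0 1 + v 1 • Pi.single 1 1 := by
    ext j; fin_cases j <;> simp
  conv_lhs => rw [hv, map_add, map_smul, map_smul, hx, hx]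
  ext i
  simp [Matrix.mulVec, dotProduct, Fin.sum_univ_two, eisVec]
  ring

theorem exists_isInducedBy_eisWord {f : Equiv.Perm A} (hf : f ∈ AutDA) (h0 : f 0 = 0) :
    ∃ x, IsInducedBy f (eisWord x) := by
  obtain ⟨M, hM⟩ := exists_isInducedBy_of_mem_AutDA hf h0
  have h0' : f⁻¹ 0 = 0 := by rw [Equiv.Perm.inv_eq_iff_eq, h0]
  obtain ⟨N, hN⟩ := exists_isInducedBy_of_mem_AutDA (AutDA.inv_mem hf) h0'
  have hMN : M * N = 1 := (hM.mul hN).unique (by rw [mul_inv_cancel]; exact .one)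
  have hlat : EisLattice (M *ᵥ eisDir 0) := by
    have h1 : eisVec (eisDir 0) ∈ ΛA := eisVec_mem_ΛA_iff.2 (by decide)
    rw [← eisVec_mem_ΛA_iff, ← map_mulVec_eisVec, ← π_eq_zero_iff, ← hM, π_eq_zero_iff.2 h1, h0]
  obtain ⟨x, rfl⟩ := exists_eisWord hMN hlat fun j => by
    obtain ⟨k, hk⟩ := exists_preimage_curve_eq (stabDA.inv_mem hf.2) j
    refine ⟨k, ?_⟩
    set z := eisForm k ⬝ᵥ M *ᵥ eisDir j with hz
    -- The whole line V_j maps into one curve, so ℂz consists of Eisenstein integers. If z ≠ 0, then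
    -- t = 1/(2z) would make 1/2 an Eisenstein integer.
    have h1 : ∀ t : ℂ, ∃ x, t * eisToComplex z = eisToComplex x := fun t => by
      have h2 : π (t • eisVec (eisDir j)) ∈ curve j := π_mem_curve_iff.2 ⟨0, by
        rw [dotProduct_smul, eisVec_dotProduct, eisForm_dotProduct_eisDir, map_zero, smul_zero]⟩
      have h3 : f (π (t • eisVec (eisDir j))) ∈ curve k := by
        rw [← hk]
        change f.symm (f _) ∈ curve j
        rwa [Equiv.symm_apply_apply]
      rw [hM, π_mem_curve_iff, Matrix.mulVec_smul, map_mulVec_eisVec, dotProduct_smul,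
        eisVec_dotProduct] at h3
      exact h3
    by_contra hne
    have hne' : eisToComplex z ≠ 0 := fun h => hne (eisToComplex_injective (h.trans (map_zero _).symm))
    obtain ⟨x, hx⟩ := h1 ((1 / 2) * (eisToComplex z)⁻¹)
    rw [mul_assoc, inv_mul_cancel₀ hne', mul_one] at hx
    have hx0 : x ≠ 0 := by
      rintro rfl
      rw [map_zero] at hx
      norm_num at hx
    have := one_le_norm_eisToComplex hx0
    rw [← hx] at this
    norm_num at this
  exact ⟨x, hM⟩

/-! ### The group generated by g₂ and g₃, its order and its reduction. -/

theorem exists_mem_Aut₀DA_isInducedBy (x) : ∃ f ∈ Aut₀DA, IsInducedBy f (eisWord x) := by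
  have h2 : g₂ ∈ Aut₀DA := Subgroup.subset_closure (by simp)
  have h3 : g₃ ∈ Aut₀DA := Subgroup.subset_closure (by simp)
  exact ⟨_, mul_mem (mul_mem (pow_mem h2 _)
    (pow_mem (mul_mem (mul_mem h3 h2) (inv_mem h3)) _)) (pow_mem h3 _),
    ((isInducedBy_g₂.pow _).mul
      (((isInducedBy_g₃.mul isInducedBy_g₂).mul isInducedBy_g₃_inv).pow _)).mul
      (isInducedBy_g₃.pow _)⟩

theorem Aut₀DA_le_AutDA : Aut₀DA ≤ AutDA :=
  (Subgroup.closure_le _).2 (by rintro f (rfl | rfl); exacts [g₂_mem_AutDA, g₃_mem_AutDA])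

theorem mem_Aut₀DA_of_apply_zero {f : Equiv.Perm A} (hf : f ∈ AutDA) (h0 : f 0 = 0) :
    f ∈ Aut₀DA := by
  obtain ⟨x, hx⟩ := exists_isInducedBy_eisWord hf h0
  obtain ⟨g, hg, hgx⟩ := exists_mem_Aut₀DA_isInducedBy x
  rwa [hx.perm_eq hgx]

theorem σ_zero : σ 0 = 0 := map_zero (QuotientAddGroup.map ΛA ΛA antilin antilin_mem)

theorem σ_add (x y : A) : σ (x + y) = σ x + σ y :=
  map_add (QuotientAddGroup.map ΛA ΛA antilin antilin_mem) x y

theorem apply_zero_of_mem_Kl₀DA {f : Equiv.Perm A} (hf : f ∈ Kl₀DA) : f 0 = 0 := by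
  have h : Kl₀DA ≤ MulAction.stabilizer (Equiv.Perm A) (0 : A) := by
    refine (Subgroup.closure_le _).2 ?_
    rintro f (rfl | rfl | rfl)
    · exact map_zero (QuotientAddGroup.map ΛA ΛA (ofMatrix M₂) M₂_mem)
    · exact map_zero (QuotientAddGroup.map ΛA ΛA (ofMatrix M₃) M₃_mem)
    · exact σ_zero
  exact h hf

theorem Aut₀DA_le_Kl₀DA : Aut₀DA ≤ Kl₀DA :=
  Subgroup.closure_mono (by rintro f (rfl | rfl) <;> simp)

theorem exists_isInducedBy_of_mem_Aut₀DA {f : Equiv.Perm A} (hf : f ∈ Aut₀DA) :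
    ∃ x, IsInducedBy f (eisWord x) :=
  exists_isInducedBy_eisWord (Aut₀DA_le_AutDA hf) (apply_zero_of_mem_Kl₀DA (Aut₀DA_le_Kl₀DA hf))

theorem mem_Aut₀DA_iff (f : Equiv.Perm A) :
    f ∈ Aut₀DA ↔ f ∈ AutDA ∧ ∀ x y, f (x + y) = f x + f y := by
  refine ⟨fun hf => ⟨Aut₀DA_le_AutDA hf, ?_⟩, fun ⟨hf, hadd⟩ => mem_Aut₀DA_of_apply_zero hf ?_⟩
  · obtain ⟨x, hx⟩ := exists_isInducedBy_of_mem_Aut₀DA hf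
    exact hx.map_add
  · simpa using hadd 0 0

/-- The index of the matrix of an element of `Aut₀(A, D_A)`. -/
def wordIndex (f : Aut₀DA) : Fin 4 × Fin 2 × Fin 3 :=
  (exists_isInducedBy_of_mem_Aut₀DA f.2).choose

theorem isInducedBy_wordIndex (f : Aut₀DA) : IsInducedBy f (eisWord (wordIndex f)) :=
  (exists_isInducedBy_of_mem_Aut₀DA f.2).choose_spec

theorem wordIndex_bijective : Function.Bijective wordIndex := by
  constructor
  · intro f g h
    exact Subtype.ext ((isInducedBy_wordIndex f).perm_eq (h ▸ isInducedBy_wordIndex g))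
  · intro x
    obtain ⟨f, hf, hfx⟩ := exists_mem_Aut₀DA_isInducedBy x
    refine ⟨⟨f, hf⟩, eisWord_map_eisMod_injective ?_⟩
    exact congrArg (fun M => M.map eisMod) ((isInducedBy_wordIndex ⟨f, hf⟩).unique hfx)

theorem card_Aut₀DA : Nat.card Aut₀DA = 24 := by
  rw [Nat.card_congr (Equiv.ofBijective _ wordIndex_bijective)]
  simp

/-- The reduction of `Aut₀(A, D_A)` modulo `√-3`. -/
def reduction : Aut₀DA →* Matrix.SpecialLinearGroup (Fin 2) (ZMod 3) :=
  MonoidHom.mk' (fun f => ⟨(eisWord (wordIndex f)).map eisMod, det_map_eisMod_eisWord _⟩)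
    fun f g => Subtype.ext (by
      change (eisWord (wordIndex (f * g))).map eisMod
        = (eisWord (wordIndex f)).map eisMod * (eisWord (wordIndex g)).map eisMod
      rw [← Matrix.map_mul, (isInducedBy_wordIndex (f * g)).unique
        ((isInducedBy_wordIndex f).mul (isInducedBy_wordIndex g))])

theorem reduction_bijective : Function.Bijective reduction := by
  refine Function.Injective.bijective_of_nat_card_le (fun f g h => ?_) ?_
  · exact wordIndex_bijective.1 (eisWord_map_eisMod_injective (congrArg Subtype.val h))
  · rw [card_Aut₀DA, Nat.card_eq_fintype_card, card_SL_two_three]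

/-! ### The translation `τ` and the anti-holomorphic involution `σ` -/

theorem τ_apply' (x : A) : τ x = x + π ![ζ, 0] := rfl

theorem π_ζ_vec_add_self : π ![ζ, 0] + π ![ζ, 0] = 0 := by
  rw [← π_add, π_eq_zero_iff]
  have := mem_ΛA_of 0 2 0 (-1) (ζ + ζ) 0 (by push_cast; ring) (by push_cast; ring)
  simpa using this

theorem τ_sq : τ ^ 2 = 1 := by
  ext x
  rw [sq, Equiv.Perm.mul_apply, τ_apply', τ_apply', add_assoc, π_ζ_vec_add_self, add_zero]; rfl

theorem τ_zero : τ 0 = π ![ζ, 0] := zero_add (π ![ζ, 0])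

theorem τ_isHolomorphic : IsHolomorphic τ := fun _ =>
  ⟨Set.univ, isOpen_univ, trivial, fun w => w + ![ζ, 0],
    (differentiable_id.add_const _).differentiableOn, fun w _ => τ_apply w⟩

theorem τ_mem_AutDA : τ ∈ AutDA := by
  have h1 : τ.symm = τ := inv_eq_of_mul_eq_one_left (by rw [← sq, τ_sq])
  refine ⟨⟨τ_isHolomorphic, by rw [h1]; exact τ_isHolomorphic⟩, mem_stabDA_of_perm 1 fun k => ?_⟩
  refine preimage_curve_eq_of_lift τ_apply fun v => ?_
  obtain ⟨y, hy⟩ := mem_ΛA'_iff.1 ζ_vec_mem_ΛA'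
  rw [dotProduct_add, hy, eisVec_dotProduct]
  constructor
  · rintro ⟨x, hx⟩
    exact ⟨x - eisForm k ⬝ᵥ y, by rw [map_sub, ← hx, add_sub_cancel_right]; rfl⟩
  · rintro ⟨x, hx⟩
    exact ⟨x + eisForm k ⬝ᵥ y, by rw [map_add, ← hx]; rfl⟩

theorem σ_sq : σ * σ = 1 := by
  ext x
  obtain ⟨v, rfl⟩ := π_surjective x
  exact congrArg π (antilin_antilin v)

theorem σ_isAntiholomorphic : IsAntiholomorphic σ := fun _ =>
  ⟨Set.univ, isOpen_univ, trivial, antilin, by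
    refine Differentiable.differentiableOn (differentiable_pi.2 fun i => ?_)
    fin_cases i <;> simp [antilin_apply] <;> fun_prop, fun w _ => σ_apply w⟩

theorem exists_conj_eq_iff (z : ℂ) :
    (∃ x, conj z = eisToComplex x) ↔ ∃ x, z = eisToComplex x := by
  constructor
  · rintro ⟨x, hx⟩
    obtain ⟨y, hy⟩ := exists_conj_eisToComplex x
    exact ⟨y, by rw [hy, ← hx, Complex.conj_conj]⟩
  · rintro ⟨x, rfl⟩
    obtain ⟨y, hy⟩ := exists_conj_eisToComplex x
    exact ⟨y, hy.symm⟩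

/-- The antilinear map swaps V₁ and V₂ and preserves V₃ and V₄. It carries each form to a unit times
the conjugate of a form, and conjugation preserves the Eisenstein integers. -/
theorem σ_mem_stabDA : σ ∈ stabDA := by
  have hζ := ζ_sq
  refine mem_stabDA_of_perm (Equiv.swap 0 1) fun k => ?_
  refine preimage_curve_eq_of_lift (F := antilin) σ_apply fun v => ?_
  have h : ∃ u u' : Eis, u' * u = 1 ∧ eisVec (eisForm k) ⬝ᵥ antilin v
      = eisToComplex u * conj (eisVec (eisForm (Equiv.swap 0 1 k)) ⬝ᵥ v) := by
    have h1 : (-ω : Eis) * (ω - 1) = 1 := by decide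
    have h2 : (-ω : Eis) * (1 - ω) = -1 := by decide
    have s0 : Equiv.swap (0 : Fin 4) 1 0 = 1 := by decide
    have s1 : Equiv.swap (0 : Fin 4) 1 1 = 0 := by decide
    have s2 : Equiv.swap (0 : Fin 4) 1 2 = 2 := by decide
    have s3 : Equiv.swap (0 : Fin 4) 1 3 = 3 := by decide
    simp only [dotProduct, Fin.sum_univ_two, antilin_apply, eisVec]
    fin_cases k <;> simp [s0, s1, s2, s3, eisForm, eisToComplex_omega, conj_ζ]
    · exact ⟨ω - 1, ⟨-ω, h1⟩, by simp [eisToComplex_omega]⟩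
    · exact ⟨ω - 1, ⟨-ω, h1⟩, by simp [eisToComplex_omega]⟩
    · exact ⟨1 - ω, ⟨ω, by decide⟩, by simp [eisToComplex_omega]; ring⟩
    · exact ⟨1, ⟨1, by decide⟩, by
        simp; linear_combination (-conj (v 1)) * hζ⟩
  obtain ⟨u, u', hu, h⟩ := h
  rw [h, exists_mul_eq_iff hu, exists_conj_eq_iff]

theorem σ_mem_KlDA : σ ∈ KlDA :=
  ⟨Or.inr ⟨σ_isAntiholomorphic, σ_isAntiholomorphic⟩, σ_mem_stabDA⟩

theorem σ_notMem_Aut₀DA : σ ∉ Aut₀DA := by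
  intro h
  obtain ⟨x, hx⟩ := exists_isInducedBy_of_mem_Aut₀DA h
  have h1 := eq_of_forall_π_eq (ofMatrix ((eisWord x).map eisToComplex)) antilin
    fun v => (hx v).symm
  have h2 := congrFun (h1 ![1, 0]) 1
  have h3 := congrFun (h1 ![ζ, 0]) 1
  simp [ofMatrix_apply, antilin_apply, Matrix.mulVec, dotProduct, Fin.sum_univ_two, conj_ζ]
    at h2 h3
  rw [h2] at h3
  -- At ζe₁ the second coordinate would be ζ(ζ - 1) = -1 by linearity, but it is (ζ - 1)(1 - ζ) = ζ
  -- by antilinearity.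
  have h4 : ζ = -1 := by linear_combination -h3 + 2 * ζ_sq
  have h5 := congrArg Complex.re h4
  norm_num [ζ] at h5

theorem AutDA_le_KlDA : AutDA ≤ KlDA := fun _ hf => ⟨Or.inl hf.1, hf.2⟩

theorem mem_AutDA_or_mul_σ_mem {f : Equiv.Perm A} (hf : f ∈ KlDA) :
    f ∈ AutDA ∨ f * σ ∈ AutDA := by
  rcases hf.1 with h | h
  · exact Or.inl ⟨h, hf.2⟩
  · exact Or.inr ⟨⟨h.1.comp σ_isAntiholomorphic, σ_isAntiholomorphic.comp h.2⟩,
      stabDA.mul_mem hf.2 σ_mem_stabDA⟩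

theorem Kl₀DA_le_KlDA : Kl₀DA ≤ KlDA := by
  refine (Subgroup.closure_le _).2 ?_
  rintro f (rfl | rfl | rfl)
  exacts [AutDA_le_KlDA g₂_mem_AutDA, AutDA_le_KlDA g₃_mem_AutDA, σ_mem_KlDA]

theorem σ_mem_Kl₀DA : σ ∈ Kl₀DA := Subgroup.subset_closure (by simp)

theorem mem_Kl₀DA_of_apply_zero {f : Equiv.Perm A} (hf : f ∈ KlDA) (h0 : f 0 = 0) :
    f ∈ Kl₀DA := by
  rcases mem_AutDA_or_mul_σ_mem hf with h | h
  · exact Aut₀DA_le_Kl₀DA (mem_Aut₀DA_of_apply_zero h h0)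
  · have h1 : (f * σ) 0 = 0 := by rw [Equiv.Perm.mul_apply, σ_zero, h0]
    have h2 := Kl₀DA.mul_mem (Aut₀DA_le_Kl₀DA (mem_Aut₀DA_of_apply_zero h h1)) σ_mem_Kl₀DA
    rwa [mul_assoc, σ_sq, mul_one] at h2

theorem apply_zero_or_τ_mul_apply_zero {f : Equiv.Perm A} (hf : f ∈ stabDA) :
    f 0 = 0 ∨ (τ * f) 0 = 0 := by
  refine (apply_zero_of_mem_stabDA hf).imp_right fun h => ?_
  rw [Equiv.Perm.mul_apply, h, τ_apply', π_ζ_vec_add_self]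

/-- An additive f fixes 0, so it also fixes a, the only other common point of the curves. -/
theorem commute_τ_of_map_add {f : Equiv.Perm A} (hf : f ∈ stabDA)
    (hadd : ∀ x y, f (x + y) = f x + f y) : Commute f τ := by
  ext x
  rw [Equiv.Perm.mul_apply, Equiv.Perm.mul_apply, τ_apply', τ_apply', hadd,
    apply_π_ζ_vec_of_mem_stabDA hf (by simpa using hadd 0 0)]

theorem commute_τ_of_mem_Kl₀DA {f : Equiv.Perm A} (hf : f ∈ Kl₀DA) : Commute f τ := by
  have h : Kl₀DA ≤ Subgroup.centralizer {τ} := by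
    refine (Subgroup.closure_le _).2 ?_
    rintro f (rfl | rfl | rfl) <;> rw [SetLike.mem_coe, Subgroup.mem_centralizer_singleton_iff]
    · exact commute_τ_of_map_add g₂_mem_AutDA.2 isInducedBy_g₂.map_add
    · exact commute_τ_of_map_add g₃_mem_AutDA.2 isInducedBy_g₃.map_add
    · exact commute_τ_of_map_add σ_mem_stabDA σ_add
  exact Subgroup.mem_centralizer_singleton_iff.1 (h hf)

theorem τ_notMem_Kl₀DA : τ ∉ Kl₀DA := fun h =>
  π_ζ_vec_ne_zero (τ_zero.symm.trans (apply_zero_of_mem_Kl₀DA h))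

theorem relIndex_Aut₀DA_Kl₀DA : Aut₀DA.relIndex Kl₀DA = 2 := by
  refine Subgroup.index_eq_two_iff.2 ⟨⟨σ, σ_mem_Kl₀DA⟩, fun ⟨f, hf⟩ => ?_⟩
  rw [Subgroup.mem_subgroupOf, Subgroup.mem_subgroupOf, xor_iff_or_and_not_and]
  change (f * σ ∈ Aut₀DA ∨ f ∈ Aut₀DA) ∧ ¬(f * σ ∈ Aut₀DA ∧ f ∈ Aut₀DA)
  have h0 := apply_zero_of_mem_Kl₀DA hf
  constructor
  · rcases mem_AutDA_or_mul_σ_mem (Kl₀DA_le_KlDA hf) with h | h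
    · exact Or.inr (mem_Aut₀DA_of_apply_zero h h0)
    · exact Or.inl (mem_Aut₀DA_of_apply_zero h (by rw [Equiv.Perm.mul_apply, σ_zero, h0]))
  · rintro ⟨h1, h2⟩
    exact σ_notMem_Aut₀DA ((Subgroup.mul_mem_cancel_left _ h2).1 h1)

theorem KlDA_eq_closure : KlDA = Subgroup.closure ((AutDA : Set (Equiv.Perm A)) ∪ {σ}) := by
  refine le_antisymm (fun f hf => ?_) ((Subgroup.closure_le _).2 ?_)
  · have hσ : σ ∈ Subgroup.closure ((AutDA : Set (Equiv.Perm A)) ∪ {σ}) :=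
      Subgroup.subset_closure (by simp)
    rcases mem_AutDA_or_mul_σ_mem hf with h | h
    · exact Subgroup.subset_closure (Or.inl h)
    · exact (Subgroup.mul_mem_cancel_right _ hσ).1 (Subgroup.subset_closure (Or.inl h))
  · rintro f (hf | rfl)
    exacts [AutDA_le_KlDA hf, σ_mem_KlDA]

end TypeTwo

end

/-! ### Assembly of the two direct products. -/

theorem mainTheorem9 :
    -- (a) `Aut(A, D_A) = Aut₀(A, D_A) × ⟨τ⟩` with `⟨τ⟩ ≃ ℤ/2`, as an internal direct product
    (TypeTwo.Aut₀DA ≤ TypeTwo.AutDA ∧ TypeTwo.τ ∈ TypeTwo.AutDA ∧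
      ∃ φ : TypeTwo.Aut₀DA × Multiplicative (ZMod 2) ≃* TypeTwo.AutDA,
        (∀ g : TypeTwo.Aut₀DA, (φ (g, 1) : Equiv.Perm TypeTwo.A) = g) ∧
        (φ (1, Multiplicative.ofAdd 1) : Equiv.Perm TypeTwo.A) = TypeTwo.τ) ∧
    -- `Aut₀(A, D_A) = ⟨g₂, g₃⟩` consists of the group automorphisms of `A` in `Aut(A, D_A)`
    (∀ f : Equiv.Perm TypeTwo.A,
      f ∈ TypeTwo.Aut₀DA ↔ f ∈ TypeTwo.AutDA ∧ ∀ x y, f (x + y) = f x + f y) ∧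
    Nonempty (TypeTwo.Aut₀DA ≃* Matrix.SpecialLinearGroup (Fin 2) (ZMod 3)) ∧
    Nat.card TypeTwo.Aut₀DA = 24 ∧
    -- (b) `Kl(A, D_A)` is generated by `Aut(A, D_A)` and the anti-holomorphic involution `σ`
    (TypeTwo.IsAntiholomorphic TypeTwo.σ ∧ orderOf TypeTwo.σ = 2 ∧
      TypeTwo.KlDA =
        Subgroup.closure ((TypeTwo.AutDA : Set (Equiv.Perm TypeTwo.A)) ∪ {TypeTwo.σ})) ∧
    orderOf TypeTwo.τ = 2 ∧ Commute TypeTwo.τ TypeTwo.σ ∧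
    -- `Kl(A, D_A) = Kl₀(A, D_A) × ⟨τ⟩`, as an internal direct product
    (TypeTwo.Kl₀DA ≤ TypeTwo.KlDA ∧
      ∃ ψ : TypeTwo.Kl₀DA × Multiplicative (ZMod 2) ≃* TypeTwo.KlDA,
        (∀ g : TypeTwo.Kl₀DA, (ψ (g, 1) : Equiv.Perm TypeTwo.A) = g) ∧
        (ψ (1, Multiplicative.ofAdd 1) : Equiv.Perm TypeTwo.A) = TypeTwo.τ) ∧
    TypeTwo.Aut₀DA ≤ TypeTwo.Kl₀DA ∧ TypeTwo.Aut₀DA.relIndex TypeTwo.Kl₀DA = 2 := by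
  have hτA : TypeTwo.τ ∉ TypeTwo.Aut₀DA := fun h =>
    TypeTwo.τ_notMem_Kl₀DA (TypeTwo.Aut₀DA_le_Kl₀DA h)
  refine ⟨⟨TypeTwo.Aut₀DA_le_AutDA, TypeTwo.τ_mem_AutDA, ?_⟩, TypeTwo.mem_Aut₀DA_iff,
    ⟨MulEquiv.ofBijective _ TypeTwo.reduction_bijective⟩, TypeTwo.card_Aut₀DA,
    ⟨TypeTwo.σ_isAntiholomorphic, ?_, TypeTwo.KlDA_eq_closure⟩, ?_,
    (TypeTwo.commute_τ_of_mem_Kl₀DA TypeTwo.σ_mem_Kl₀DA).symm, ⟨TypeTwo.Kl₀DA_le_KlDA, ?_⟩,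
    TypeTwo.Aut₀DA_le_Kl₀DA, TypeTwo.relIndex_Aut₀DA_Kl₀DA⟩
  · refine Subgroup.exists_mulEquiv_prod_zmod_two TypeTwo.Aut₀DA_le_AutDA TypeTwo.τ_mem_AutDA
      TypeTwo.τ_sq hτA
      (fun f hf => TypeTwo.commute_τ_of_mem_Kl₀DA (TypeTwo.Aut₀DA_le_Kl₀DA hf)) fun f hf => ?_
    exact (TypeTwo.apply_zero_or_τ_mul_apply_zero hf.2).imp
      (TypeTwo.mem_Aut₀DA_of_apply_zero hf)
      (TypeTwo.mem_Aut₀DA_of_apply_zero (mul_mem TypeTwo.τ_mem_AutDA hf))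
  · exact orderOf_eq_prime (by rw [sq, TypeTwo.σ_sq])
      fun h => TypeTwo.σ_notMem_Aut₀DA (h ▸ one_mem _)
  · exact orderOf_eq_prime TypeTwo.τ_sq fun h => hτA (h ▸ one_mem _)
  · refine Subgroup.exists_mulEquiv_prod_zmod_two TypeTwo.Kl₀DA_le_KlDA
      (TypeTwo.AutDA_le_KlDA TypeTwo.τ_mem_AutDA) TypeTwo.τ_sq TypeTwo.τ_notMem_Kl₀DA
      (fun f hf => TypeTwo.commute_τ_of_mem_Kl₀DA hf) fun f hf => ?_
    exact (TypeTwo.apply_zero_or_τ_mul_apply_zero hf.2).imp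
      (TypeTwo.mem_Kl₀DA_of_apply_zero hf)
      (TypeTwo.mem_Kl₀DA_of_apply_zero
        (mul_mem (TypeTwo.AutDA_le_KlDA TypeTwo.τ_mem_AutDA) hf))
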